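/- Let $A\in\mathbb{C}^{m\times m}$, $B\in\mathbb{C}^{m\times g}$, $C\in\mathbb{C}^{l\times m}$ with $m\ge 1$, let $\sigma,\sigma'>0$ be (finite) real numbers and let $p_e\in[0,1]$. An intermittent system $(A,B,C,\sigma,\sigma')$ with erasure probability $p_e$ consists of random processes $$x[n+1]=Ax[n]+Bw[n],\qquad y[n]=\beta[n]\,(Cx[n]+v[n])\qquad(n=0,1,2,\dots)$$ with values $x[n]\in\mathbb{C}^m$, $w[n]\in\mathbb{C}^g$, $v[n],y[n]\in\mathbb{C}^l$, such that the random variables $x[0]$, $w[n]$, $v[n]$, $\beta[n]$ ($n\ge 0$) are mutually independent; $x[0],w[n],v[n]$ are zero-mean Gaussian vectors with $\mathbb{E}[x[0]x[0]^\dagger]\preceq\sigma^2 I$, $\sigma'^2I\preceq\mathbb{E}[w[n]w[n]^\dagger]\preceq\sigma^2I$ and $\sigma'^2I\preceq\mathbb{E}[v[n]v[n]^\dagger]\preceq\sigma^2I$ for all $n$; and $\mathbb{P}(\beta[n]=0)=p_e$, $\mathbb{P}(\beta[n]=1)=1-p_e$ for all $n$. The system is called intermittent observable if there is a causal estimator $\hat{x}[n]$,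 i.e. a measurable function of $y[0],\dots,y[n]$ for each $n$, with $$\sup_{n\ge 0}\mathbb{E}\big[(x[n]-\hat{x}[n])^\dagger(x[n]-\hat{x}[n])\big]<\infty .$$ Assume that $(A,B)$ is controllable, i.e. $[\,B\ \ AB\ \cdots\ A^{m-1}B\,]$ has rank $m$; that $(A,C)$ is observable, i.e. the matrix with block rows $C,CA,\dots,CA^{m-1}$ has rank $m$; and that $A$ has no eigenvalue cycles, i.e. $(\lambda/\mu)^n\ne 1$ for all distinct eigenvalues $\lambda,\mu$ of $A$ and all integers $n\ge 1$ (where $\lambda/0=\infty$). Let $\lambda_{\max}$ be an eigenvalue of $A$ of largest magnitude. Then the system is intermittent observable if and only if $$p_e<\frac{1}{|\lambda_{\max}|^2},$$ where $1/0=\infty$. -/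

import Mathlib

open MeasureTheory ProbabilityTheory
open scoped ComplexOrder

/-- `(A, B)` is controllable: the controllability matrix `[B  AB  ⋯  A^(m-1) B]` has rank `m`. -/
def IsControllable {m g : ℕ} (A : Matrix (Fin m) (Fin m) ℂ) (B : Matrix (Fin m) (Fin g) ℂ) :
    Prop :=
  (Matrix.of fun (i : Fin m) (kj : Fin m × Fin g) => (A ^ (kj.1 : ℕ) * B) i kj.2).rank = m

/-- `(A, C)` is observable: the observability matrix with block rows `C, CA, …, C A^(m-1)`
has rank `m`. -/
def IsObservable {m l : ℕ} (A : Matrix (Fin m) (Fin m) ℂ) (C : Matrix (Fin l) (Fin m) ℂ) :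
    Prop :=
  (Matrix.of fun (ki : Fin m × Fin l) (j : Fin m) => (C * A ^ (ki.1 : ℕ)) ki.2 j).rank = m

/-- `A` has no eigenvalue cycles: no ratio of distinct eigenvalues is a root of unity.
(If `b = 0`, then Lean's `a / b` is `0`, whose positive powers are not `1` either.) -/
def NoEigenvalueCycles {m : ℕ} (A : Matrix (Fin m) (Fin m) ℂ) : Prop :=
  ∀ a ∈ spectrum ℂ A, ∀ b ∈ spectrum ℂ A, a ≠ b → ∀ n : ℕ, 1 ≤ n → (a / b) ^ n ≠ 1

/-- The matrix of second moments `𝔼[X X†]` of a complex random vector `X`. -/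
noncomputable def secondMoment {Ω : Type*} [MeasurableSpace Ω] (P : Measure Ω) {k : ℕ}
    (X : Ω → Fin k → ℂ) : Matrix (Fin k) (Fin k) ℂ :=
  Matrix.of fun i j => ∫ ω, X ω i * star (X ω j) ∂P

/-- An intermittent system `(A, B, C, σ, σ')` with erasure probability `pe`, on a probability
space `(Ω, P)`: state `x`, driving disturbance `w`, observation noise `v`, packet drops `β`
and observation `y`. -/
structure IntermittentSystem {m g l : ℕ} (A : Matrix (Fin m) (Fin m) ℂ)
    (B : Matrix (Fin m) (Fin g) ℂ) (C : Matrix (Fin l) (Fin m) ℂ) (σ σ' pe : ℝ)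
    {Ω : Type*} [MeasurableSpace Ω] (P : Measure Ω) where
  x : ℕ → Ω → Fin m → ℂ
  w : ℕ → Ω → Fin g → ℂ
  v : ℕ → Ω → Fin l → ℂ
  β : ℕ → Ω → ℝ
  y : ℕ → Ω → Fin l → ℂ
  /-- the state equation `x[n+1] = A x[n] + B w[n]` -/
  state_eq : ∀ n ω, x (n + 1) ω = A.mulVec (x n ω) + B.mulVec (w n ω)
  /-- the observation equation `y[n] = β[n] (C x[n] + v[n])` -/
  obs_eq : ∀ n ω, y n ω = (β n ω : ℂ) • (C.mulVec (x n ω) + v n ω)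
  measurable_x0 : Measurable (x 0)
  measurable_w : ∀ n, Measurable (w n)
  measurable_v : ∀ n, Measurable (v n)
  measurable_β : ∀ n, Measurable (β n)
  /-- The random variables `x[0]`, `w[n]`, `v[n]`, `β[n]` (`n = 0, 1, …`) are mutually
  independent: the family of the `σ`-algebras that they generate is independent. -/
  indep : iIndep
    (Sum.elim (fun _ : Unit => MeasurableSpace.comap (x 0) inferInstance)
      (Sum.elim (fun n : ℕ => MeasurableSpace.comap (w n) inferInstance)
        (Sum.elim (fun n : ℕ => MeasurableSpace.comap (v n) inferInstance)
          (fun n : ℕ => MeasurableSpace.comap (β n) inferInstance)))) P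
  /-- Each of the vectors is Gaussian; with `indep`, they are jointly Gaussian. Gaussian means
  that the real and imaginary parts of the entries are jointly Gaussian. -/
  gaussian_x0 : HasGaussianLaw (x 0) P
  gaussian_w : ∀ n, HasGaussianLaw (w n) P
  gaussian_v : ∀ n, HasGaussianLaw (v n) P
  mean_x0 : ∫ ω, x 0 ω ∂P = 0
  mean_w : ∀ n, ∫ ω, w n ω ∂P = 0
  mean_v : ∀ n, ∫ ω, v n ω ∂P = 0
  /-- `𝔼[x[0] x[0]†] ⪯ σ² I`, and likewise for `w[n]` and `v[n]` -/
  upper_x0 : (((σ : ℂ) ^ 2) • (1 : Matrix (Fin m) (Fin m) ℂ) - secondMoment P (x 0)).PosSemidef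
  upper_w : ∀ n,
    (((σ : ℂ) ^ 2) • (1 : Matrix (Fin g) (Fin g) ℂ) - secondMoment P (w n)).PosSemidef
  upper_v : ∀ n,
    (((σ : ℂ) ^ 2) • (1 : Matrix (Fin l) (Fin l) ℂ) - secondMoment P (v n)).PosSemidef
  /-- `𝔼[w[n] w[n]†] ⪰ σ'² I`, and likewise for `v[n]` -/
  lower_w : ∀ n,
    (secondMoment P (w n) - ((σ' : ℂ) ^ 2) • (1 : Matrix (Fin g) (Fin g) ℂ)).PosSemidef
  lower_v : ∀ n,
    (secondMoment P (v n) - ((σ' : ℂ) ^ 2) • (1 : Matrix (Fin l) (Fin l) ℂ)).PosSemidef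
  /-- `β[n]` is `0` with probability `pe` and `1` with probability `1 - pe`. -/
  prob_erased : ∀ n, P.real {ω | β n ω = 0} = pe
  prob_received : ∀ n, P.real {ω | β n ω = 1} = 1 - pe

/-- The system is intermittent observable: there is a causal estimator
`x̂[n] = f n (y[0], …, y[n])` of `x[n]` with
`sup_n 𝔼[(x[n] - x̂[n])† (x[n] - x̂[n])] < ∞`. -/
def IntermittentSystem.IsIntermittentObservable {m g l : ℕ} {A : Matrix (Fin m) (Fin m) ℂ}
    {B : Matrix (Fin m) (Fin g) ℂ} {C : Matrix (Fin l) (Fin m) ℂ} {σ σ' pe : ℝ}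
    {Ω : Type*} [MeasurableSpace Ω] {P : Measure Ω}
    (S : IntermittentSystem A B C σ σ' pe P) : Prop :=
  ∃ f : (n : ℕ) → (Fin (n + 1) → Fin l → ℂ) → Fin m → ℂ,
    (∀ n, Measurable (f n)) ∧
    (⨆ n : ℕ, ∫⁻ ω, (∑ i, ‖S.x n ω i - f n (fun k => S.y k ω) i‖ₑ ^ 2) ∂P) < ⊤

/-! Necessity. Take a left eigenvector `u` of `A` with eigenvalue `a`; by controllability `q = u B`
is nonzero. If the packet at time `n + 1` is erased, the estimate of `u ⬝ᵥ x[n+1] = a * (u ⬝ᵥ x[n])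
+ q ⬝ᵥ w[n]` uses only the past, of which `w[n]` is independent. Hence the least mean square errors
satisfy `e[n+1] ≥ pe * (‖a‖ ^ 2 * e[n] + c)` with `c > 0`, and they are unbounded when `pe * ‖a‖ ^ 2
≥ 1` (`le_lintegral_enorm_sq_sub`).

Sufficiency. Time is cut into blocks of length `N`. If the packets received in a block determine the
state at its end, a linear decoder resets the error to the size of the noise; otherwise the old
estimate is propagated and the error grows by at most `ρ ^ N`, for `ρ` slightly above the spectral
radius. The erasures in a block are independent of the error at its start, so the mean square error
obeys an affine recursion, contracting once `ρ ^ (2 * N)` times the probability of an undetermined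
block is small (`exists_lintegral_blockError_le`). That probability decays at a rate arbitrarily
close to `pe ^ N`, because a set of times that fails to determine the state has at most `δ * N`
elements (`card_le_of_not_determines`).

This sparsity is a uniform statement about zeros of the linear recurrences `C A^k x` without
root-of-unity ratios (`card_zeros_le`). If many zeros lie close together, many pairs of them share a
shift `b`; they are then zeros of the trajectory of `(A^b - μ^b) x`, which is killed by one linear
factor fewer, and induction applies. -/

/-! ### Zeros of linear recurrences. -/

/-- A set of naturals below `N` is controlled by a separated part and by its
self-intersections under small shifts. -/
theorem card_le_add_sum_card_shift (Z : Finset ℕ) {N B : ℕ} (hZ : Z ⊆ Finset.range N)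
    (hB : 0 < B) :
    Z.card ≤ N / B + 1 + ∑ b ∈ Finset.Icc 1 B, (Z.filter fun k => k + b ∈ Z).card := by
  classical
  -- `S` collects the points of `Z` with another point of `Z` at distance at most `B` above. Outside
  -- `S` the gaps exceed `B`, so `k ↦ k / B` is injective there.
  set S := (Finset.Icc 1 B).biUnion fun b => Z.filter fun k => k + b ∈ Z with hS
  have h1 : S.card ≤ ∑ b ∈ Finset.Icc 1 B, (Z.filter fun k => k + b ∈ Z).card :=
    Finset.card_biUnion_le
  have h2 : (Z \ S).card ≤ N / B + 1 := by
    rw [← Finset.card_range (N / B + 1)]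
    refine Finset.card_le_card_of_injOn (fun k => k / B) ?_ ?_
    · intro k hk
      have hk' := Finset.mem_range.1 (hZ (Finset.mem_sdiff.1 hk).1)
      simpa [Nat.lt_succ_iff] using Nat.div_le_div_right hk'.le
    · have key : ∀ a ∈ Z \ S, ∀ b ∈ Z, a < b → a / B ≠ b / B := by
        intro a ha b hb hab h
        rw [Finset.mem_sdiff] at ha
        refine ha.2 ?_
        rw [hS, Finset.mem_biUnion]
        have e1 := Nat.div_add_mod a B
        have e2 := Nat.div_add_mod b B
        have e3 := Nat.mod_lt b hB
        rw [h] at e1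
        refine ⟨b - a, Finset.mem_Icc.2 ⟨by omega, by omega⟩,
          Finset.mem_filter.2 ⟨ha.1, ?_⟩⟩
        rwa [Nat.add_sub_cancel' hab.le]
      intro a ha b hb h
      rcases lt_trichotomy a b with hab | hab | hab
      · exact absurd h (key a ha b (Finset.mem_sdiff.1 hb).1 hab)
      · exact hab
      · exact absurd h.symm (key b hb a (Finset.mem_sdiff.1 ha).1 hab)
  have h3 := Finset.le_card_sdiff S Z
  omega

section LinearRecurrence

variable {V W : Type*} [AddCommGroup V] [Module ℂ V] [AddCommGroup W] [Module ℂ W]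

open Polynomial in
theorem aeval_X_pow_sub_C_pow_apply (f : Module.End ℂ V) (μ : ℂ) (b : ℕ) (x : V) :
    aeval f (X ^ b - C μ ^ b) x = (f ^ b) x - μ ^ b • x := by
  rw [← C_pow, map_sub, map_pow, aeval_X, aeval_C]
  rfl

open Polynomial in
/-- If no two distinct eigenvalues of `f` have a common `b`-th power, then an eigenvector of
`f ^ b` for a nonzero `μ ^ b` is an eigenvector of `f` for `μ`. -/
theorem apply_eq_smul_of_pow_apply_eq_smul (f : Module.End ℂ V)
    (hcyc : ∀ a ∈ spectrum ℂ f, ∀ b ∈ spectrum ℂ f, a ≠ b → ∀ n : ℕ, 1 ≤ n → a ^ n ≠ b ^ n)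
    {μ : ℂ} (hμ : μ ∈ spectrum ℂ f) (hμ0 : μ ≠ 0) {b : ℕ} (hb : 1 ≤ b) {z : V}
    (hz : (f ^ b) z = μ ^ b • z) : f z = μ • z := by
  -- It suffices that `r(f)` is invertible, i.e. that `r` has no root in the spectrum. Another
  -- eigenvalue as root would have the same `b`-th power as `μ`; and `μ` itself is only a simple
  -- root of `X ^ b - μ ^ b`.
  obtain ⟨r, hr⟩ : (X - C μ : ℂ[X]) ∣ X ^ b - C μ ^ b := sub_dvd_pow_sub_pow _ _ _
  have hunit : IsUnit (aeval f r) := by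
    by_contra hnu
    have h0 : (0 : ℂ) ∈ spectrum ℂ (aeval f r) := (spectrum.zero_mem_iff ℂ).2 hnu
    rw [spectrum.map_polynomial_aeval_of_nonempty f r ⟨μ, hμ⟩] at h0
    obtain ⟨ν, hν, hν0⟩ := h0
    have hν0 : r.eval ν = 0 := hν0
    by_cases hνμ : ν = μ
    · subst hνμ
      have hd := congrArg (fun p => (derivative p).eval ν) hr
      have : (b : ℂ) * ν ^ (b - 1) = 0 := by
        rw [← C_pow, derivative_sub, derivative_X_pow, derivative_C] at hd
        simpa [derivative_mul, hν0] using hd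
      have hb0 : (b : ℂ) ≠ 0 := by exact_mod_cast (by omega : b ≠ 0)
      exact mul_ne_zero hb0 (pow_ne_zero _ hμ0) this
    · refine hcyc ν hν μ hμ hνμ b hb ?_
      have := congrArg (eval ν) hr
      simp only [eval_sub, eval_pow, eval_X, eval_C, eval_mul, hν0, mul_zero] at this
      exact sub_eq_zero.1 this
  have h1 : aeval f r (aeval f (X - C μ) z) = 0 := by
    rw [← Module.End.mul_apply, ← map_mul, mul_comm, ← hr]
    rw [aeval_X_pow_sub_C_pow_apply, hz, sub_self]
  have hinj : Function.Injective (aeval f r) := ((Module.End.isUnit_iff _).1 hunit).injective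
  have h2 := hinj (h1.trans (map_zero _).symm)
  simpa [Module.algebraMap_end_apply, sub_eq_zero] using h2

variable [FiniteDimensional ℂ V]

open Polynomial in
/-- The zeros of an observed trajectory of `f` have density zero, uniformly in the initial
state, if `f` has no eigenvalue cycles and its eigenvectors are observed. The initial state is
supposed to be killed by a product of `d` linear factors. -/
theorem card_zeros_le_of_aeval_eq_zero (f : Module.End ℂ V) (c : V →ₗ[ℂ] W)
    (hcyc : ∀ a ∈ spectrum ℂ f, ∀ b ∈ spectrum ℂ f, a ≠ b → ∀ n : ℕ, 1 ≤ n → a ^ n ≠ b ^ n)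
    (hobs : ∀ (μ : ℂ) (z : V), f z = μ • z → c z = 0 → z = 0) (d : ℕ) :
    ∀ δ : ℝ, 0 < δ → ∃ N₀ : ℕ, ∀ N ≥ N₀, ∀ s : Multiset ℂ, s.card = d →
      (∀ μ ∈ s, μ ∈ spectrum ℂ f) → ∀ x : V,
      aeval f (s.map fun μ => X - C μ).prod x = 0 → (f ^ Module.finrank ℂ V) x ≠ 0 →
      ∀ Z : Finset ℕ, Z ⊆ Finset.range N → (∀ k ∈ Z, c ((f ^ k) x) = 0) → (Z.card : ℝ) ≤ δ * N := by
  have hker : ∀ (n : ℕ) (x : V), (f ^ n) x = 0 → (f ^ Module.finrank ℂ V) x = 0 :=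
    fun n x h => Module.End.ker_pow_le_ker_pow_finrank f n h
  induction d with
  | zero =>
    intro δ hδ
    refine ⟨0, fun N _ s hs _ x hx hne => ?_⟩
    rw [Multiset.card_eq_zero.1 hs] at hx
    simp only [Multiset.map_zero, Multiset.prod_zero, map_one, Module.End.one_apply] at hx
    simp [hx] at hne
  | succ d ih =>
    intro δ hδ
    -- The bound `N / B + 1 + ∑ b` is split into three thirds of `δ * N`: `B > 3 / δ` serves the
    -- first, `δ * N > 3` the second, and density `δ / (3 * B)` for each of the `B` shifts the
    -- third. `N₁` and `N₂` are fixed before the initial state, which the induction changes.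
    obtain ⟨B, hB⟩ := exists_nat_gt (3 / δ)
    have hB0 : 0 < (B : ℝ) := (by positivity : 0 < 3 / δ).trans hB
    have hδB : 3 < δ * B := by rwa [div_lt_iff₀' hδ] at hB
    obtain ⟨N₁, hN₁⟩ := ih (δ / (3 * B)) (by positivity)
    obtain ⟨N₂, hN₂⟩ := exists_nat_gt ((Module.finrank ℂ V + 3 : ℝ) / δ)
    refine ⟨max N₁ N₂, fun N hN s hs hsp x hx hne Z hZ hZ0 => ?_⟩
    have hNN : (Module.finrank ℂ V + 3 : ℝ) < δ * N := by
      rw [div_lt_iff₀' hδ] at hN₂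
      have : (N₂ : ℝ) ≤ N := by exact_mod_cast le_of_max_le_right hN
      exact hN₂.trans_le (by gcongr)
    obtain ⟨μ, hμ⟩ := Multiset.card_pos_iff_exists_mem.1 (by omega : 0 < s.card)
    obtain ⟨t, rfl⟩ := Multiset.exists_cons_of_mem hμ
    have ht : t.card = d := by simpa using hs
    -- Either some shifted state dies, and then the trajectory is eventually geometric along an
    -- observed eigenvector, with no zeros from time `finrank` on; or the induction hypothesis
    -- applies to every shift.
    by_cases hex : ∃ b ∈ Finset.Icc 1 B, (f ^ Module.finrank ℂ V) ((f ^ b) x - μ ^ b • x) = 0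
    · obtain ⟨b, hb, hb0⟩ := hex
      have hb1 : 1 ≤ b := (Finset.mem_Icc.1 hb).1
      have hz : (f ^ b) ((f ^ Module.finrank ℂ V) x) = μ ^ b • (f ^ Module.finrank ℂ V) x := by
        rw [map_sub, map_smul, sub_eq_zero] at hb0
        rw [← hb0, ← Module.End.mul_apply, ← Module.End.mul_apply, ← pow_add, ← pow_add, add_comm]
      have hμ0 : μ ≠ 0 := by
        rintro rfl
        rw [zero_pow (by omega), zero_smul, ← Module.End.mul_apply, ← pow_add] at hz
        exact hne (hker _ _ hz)
      have hez := apply_eq_smul_of_pow_apply_eq_smul f hcyc (hsp μ hμ) hμ0 hb1 hz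
      have hlt : ∀ k ∈ Z, k < Module.finrank ℂ V := by
        intro k hk
        by_contra! hle
        have h0 := hZ0 k hk
        obtain ⟨j, rfl⟩ := Nat.exists_eq_add_of_le' hle
        have hpow : ∀ j : ℕ, (f ^ (j + Module.finrank ℂ V)) x
            = μ ^ j • (f ^ Module.finrank ℂ V) x := by
          intro j
          induction j with
          | zero => simp
          | succ j ihj =>
            rw [add_right_comm, pow_succ', Module.End.mul_apply, ihj, map_smul, hez, smul_smul,
              pow_succ]
        rw [hpow, map_smul, smul_eq_zero] at h0
        exact hne (hobs μ _ hez (h0.resolve_left (pow_ne_zero _ hμ0)))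
      have hcard : Z.card ≤ Module.finrank ℂ V := by
        rw [← Finset.card_range (Module.finrank ℂ V)]
        exact Finset.card_le_card fun k hk => Finset.mem_range.2 (hlt k hk)
      have : (Z.card : ℝ) ≤ Module.finrank ℂ V := by exact_mod_cast hcard
      linarith
    · push Not at hex
      have hb : ∀ b ∈ Finset.Icc 1 B,
          ((Z.filter fun k => k + b ∈ Z).card : ℝ) ≤ δ / (3 * B) * N := by
        intro b hb
        refine hN₁ N (le_of_max_le_left hN) t ht (fun ν hν => hsp ν (Multiset.mem_cons_of_mem hν))
          ((f ^ b) x - μ ^ b • x) ?_ (hex b hb) _ ((Finset.filter_subset _ _).trans hZ) ?_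
        -- `f ^ b - μ ^ b` contains the factor `f - μ`, so the shifted state no longer needs `μ` in
        -- the annihilating product.
        · obtain ⟨r, hr⟩ : (X - C μ : ℂ[X]) ∣ X ^ b - C μ ^ b := sub_dvd_pow_sub_pow _ _ _
          have h1 : (f ^ b) x - μ ^ b • x = aeval f (X ^ b - C μ ^ b) x :=
            (aeval_X_pow_sub_C_pow_apply f μ b x).symm
          rw [h1, hr, ← Module.End.mul_apply, ← map_mul]
          rw [Multiset.map_cons, Multiset.prod_cons] at hx
          rw [show (t.map fun μ => X - C μ).prod * ((X - C μ) * r)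
            = r * ((X - C μ) * (t.map fun μ => X - C μ).prod) by ring, map_mul,
            Module.End.mul_apply, hx, map_zero]
        · intro k hk
          rw [Finset.mem_filter] at hk
          rw [map_sub, map_smul, map_sub, map_smul, hZ0 k hk.1, smul_zero, sub_zero,
            ← Module.End.mul_apply, ← pow_add]
          exact hZ0 _ hk.2
      have h1 : (Z.card : ℝ) ≤ (N / B : ℕ) + 1
          + ∑ b ∈ Finset.Icc 1 B, ((Z.filter fun k => k + b ∈ Z).card : ℝ) := by
        exact_mod_cast card_le_add_sum_card_shift Z hZ (by exact_mod_cast hB0)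
      have h2 : ∑ b ∈ Finset.Icc 1 B, ((Z.filter fun k => k + b ∈ Z).card : ℝ)
          ≤ B * (δ / (3 * B) * N) := by
        simpa using Finset.sum_le_card_nsmul _ _ _ hb
      have h3 : ((N / B : ℕ) : ℝ) ≤ N / B := Nat.cast_div_le
      have h4 : (N : ℝ) / B ≤ δ / 3 * N := by
        rw [div_le_iff₀ hB0]
        nlinarith [(Nat.cast_nonneg N : (0 : ℝ) ≤ N)]
      have h5 : B * (δ / (3 * B) * N) = δ / 3 * N := by field_simp
      have h6 : (0 : ℝ) ≤ Module.finrank ℂ V := Nat.cast_nonneg _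
      nlinarith

/-- The zeros of an observed trajectory of `f` that never dies have density zero, uniformly in
the initial state. -/
theorem card_zeros_le (f : Module.End ℂ V) (c : V →ₗ[ℂ] W)
    (hcyc : ∀ a ∈ spectrum ℂ f, ∀ b ∈ spectrum ℂ f, a ≠ b → ∀ n : ℕ, 1 ≤ n → a ^ n ≠ b ^ n)
    (hobs : ∀ (μ : ℂ) (z : V), f z = μ • z → c z = 0 → z = 0) {δ : ℝ} (hδ : 0 < δ) :
    ∃ N₀ : ℕ, ∀ N ≥ N₀, ∀ x : V, (f ^ Module.finrank ℂ V) x ≠ 0 →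
      ∀ Z : Finset ℕ, Z ⊆ Finset.range N → (∀ k ∈ Z, c ((f ^ k) x) = 0) →
      (Z.card : ℝ) ≤ δ * N := by
  obtain ⟨N₀, h⟩ := card_zeros_le_of_aeval_eq_zero f c hcyc hobs f.charpoly.roots.card δ hδ
  refine ⟨N₀, fun N hN x hx Z hZ hZ0 => h N hN _ rfl (fun μ hμ => ?_) x ?_ hx Z hZ hZ0⟩
  · rw [← Module.End.hasEigenvalue_iff_mem_spectrum, Module.End.hasEigenvalue_iff_isRoot_charpoly]
    exact Polynomial.isRoot_of_mem_roots hμ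
  · rw [← (IsAlgClosed.splits f.charpoly).eq_prod_roots_of_monic f.charpoly_monic,
      LinearMap.aeval_self_charpoly, LinearMap.zero_apply]

end LinearRecurrence

/-! ### Observability and sets of reception times. -/

section Matrix

variable {m g l : ℕ} {A : Matrix (Fin m) (Fin m) ℂ}

/-- One direction of the Hautus test: on an eigenvector every block row `C A^k` is a multiple of
`C`. -/
theorem IsObservable.eq_zero {C : Matrix (Fin l) (Fin m) ℂ} (h : IsObservable A C) {μ : ℂ}
    {z : Fin m → ℂ} (hz : A.mulVec z = μ • z) (hC : C.mulVec z = 0) : z = 0 := by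
  have hpow : ∀ k : ℕ, (A ^ k).mulVec z = μ ^ k • z := by
    intro k
    induction k with
    | zero => simp
    | succ k ih => rw [pow_succ, ← Matrix.mulVec_mulVec, hz, Matrix.mulVec_smul, ih, smul_smul,
        pow_succ']
  have hinj : Function.Injective (Matrix.of fun (ki : Fin m × Fin l) (j : Fin m) =>
      (C * A ^ (ki.1 : ℕ)) ki.2 j).mulVec := by
    rw [Matrix.mulVec_injective_iff, linearIndependent_iff_card_eq_finrank_span,
      Set.finrank, ← Matrix.rank_eq_finrank_span_cols]
    simpa using h.symm
  refine hinj ?_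
  rw [Matrix.mulVec_zero]
  funext ki
  change (C * A ^ (ki.1 : ℕ)).mulVec z ki.2 = 0
  rw [← Matrix.mulVec_mulVec, hpow, Matrix.mulVec_smul, hC]
  simp

theorem IsControllable.eq_zero {B : Matrix (Fin m) (Fin g) ℂ} (h : IsControllable A B) {μ : ℂ}
    {u : Fin m → ℂ} (hu : Matrix.vecMul u A = μ • u) (hB : Matrix.vecMul u B = 0) : u = 0 := by
  have hpow : ∀ k : ℕ, Matrix.vecMul u (A ^ k) = μ ^ k • u := by
    intro k
    induction k with
    | zero => simp
    | succ k ih => rw [pow_succ, ← Matrix.vecMul_vecMul, ih, Matrix.smul_vecMul, hu, smul_smul,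
        pow_succ]
  have hinj : Function.Injective fun v : Fin m → ℂ => Matrix.vecMul v
      (Matrix.of fun (i : Fin m) (kj : Fin m × Fin g) => (A ^ (kj.1 : ℕ) * B) i kj.2) := by
    rw [Matrix.vecMul_injective_iff, linearIndependent_iff_card_eq_finrank_span,
      Set.finrank, ← Matrix.rank_eq_finrank_span_row]
    simpa using h.symm
  refine hinj ?_
  simp only [Matrix.zero_vecMul]
  funext kj
  change Matrix.vecMul u (A ^ (kj.1 : ℕ) * B) kj.2 = 0
  rw [← Matrix.vecMul_vecMul, hpow, Matrix.smul_vecMul, hB]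
  simp

theorem exists_vecMul_eq_smul {μ : ℂ} (hμ : μ ∈ spectrum ℂ A) :
    ∃ u : Fin m → ℂ, u ≠ 0 ∧ Matrix.vecMul u A = μ • u := by
  have h := (Matrix.exists_vecMul_eq_zero_iff (M := Matrix.scalar (Fin m) μ - A)).2 (by
    rw [spectrum.mem_iff, Matrix.isUnit_iff_isUnit_det, isUnit_iff_ne_zero, not_not] at hμ
    exact hμ)
  obtain ⟨u, hu, h⟩ := h
  refine ⟨u, hu, ?_⟩
  rw [Matrix.vecMul_sub, sub_eq_zero] at h
  rw [← h]
  simp [← Matrix.smul_one_eq_diagonal, Matrix.vecMul_smul]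

/-- The observations at the times in `R` determine the state at time `N`, in the absence of
disturbances and noise. -/
def Determines (A : Matrix (Fin m) (Fin m) ℂ) (C : Matrix (Fin l) (Fin m) ℂ) (N : ℕ)
    (R : Finset ℕ) : Prop :=
  ∃ L : ℕ → (Fin l → ℂ) →L[ℂ] (Fin m → ℂ),
    ∀ x, (A ^ N).mulVec x = ∑ k ∈ R, L k (C.mulVec ((A ^ k).mulVec x))

/-- The kernel of the observation map lies in that of `A ^ N`, so `A ^ N` factors through its range;
the factor is extended to the whole space and split into components. -/
theorem determines_of_forall {C : Matrix (Fin l) (Fin m) ℂ} {N : ℕ} {R : Finset ℕ}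
    (h : ∀ x, (∀ k ∈ R, C.mulVec ((A ^ k).mulVec x) = 0) → (A ^ N).mulVec x = 0) :
    Determines A C N R := by
  classical
  let G : (Fin m → ℂ) →ₗ[ℂ] (R → Fin l → ℂ) :=
    LinearMap.pi fun k => C.mulVecLin ∘ₗ (A ^ (k : ℕ)).mulVecLin
  have hle : LinearMap.ker G ≤ LinearMap.ker (A ^ N).mulVecLin := by
    intro x hx
    refine h x fun k hk => ?_
    exact congrFun (LinearMap.mem_ker.1 hx) ⟨k, hk⟩
  obtain ⟨T, hT⟩ := LinearMap.exists_extend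
    (((LinearMap.ker G).liftQ (A ^ N).mulVecLin hle) ∘ₗ G.quotKerEquivRange.symm.toLinearMap)
  have hTG : ∀ x, (A ^ N).mulVec x = T (G x) := by
    intro x
    have h1 := LinearMap.congr_fun hT ⟨G x, LinearMap.mem_range_self G x⟩
    have h2 : G.quotKerEquivRange.symm ⟨G x, LinearMap.mem_range_self G x⟩
        = (LinearMap.ker G).mkQ x := by
      rw [LinearEquiv.symm_apply_eq]
      rfl
    simpa [h2] using h1.symm
  refine ⟨fun k => if hk : k ∈ R then
    LinearMap.toContinuousLinearMap (T ∘ₗ LinearMap.single ℂ (fun _ : R => Fin l → ℂ) ⟨k, hk⟩) else 0, fun x => ?_⟩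
  rw [hTG, ← Finset.sum_attach]
  conv_lhs => rw [← Finset.univ_sum_single (G x), map_sum, Finset.univ_eq_attach]
  refine Finset.sum_congr rfl fun k _ => ?_
  simp [G]

theorem NoEigenvalueCycles.pow_ne (h : NoEigenvalueCycles A) :
    ∀ a ∈ spectrum ℂ A, ∀ b ∈ spectrum ℂ A, a ≠ b → ∀ n : ℕ, 1 ≤ n → a ^ n ≠ b ^ n := by
  intro a ha b hb hab n hn he
  by_cases hb0 : b = 0
  · rw [hb0, zero_pow (by omega)] at he
    exact hab ((pow_eq_zero_iff (by omega)).1 he |>.trans hb0.symm)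
  · exact h a ha b hb hab n hn (by rw [div_pow, he, div_self (pow_ne_zero _ hb0)])

/-- Sets of times which do not determine the state are sparse. -/
theorem card_le_of_not_determines {C : Matrix (Fin l) (Fin m) ℂ} (hAC : IsObservable A C)
    (hcyc : NoEigenvalueCycles A) {δ : ℝ} (hδ : 0 < δ) :
    ∃ N₀ : ℕ, ∀ N ≥ N₀, ∀ R ⊆ Finset.range N, ¬ Determines A C N R → (R.card : ℝ) ≤ δ * N := by
  have hpow : ∀ (k : ℕ) (x : Fin m → ℂ), ((Matrix.toLin' A) ^ k) x = (A ^ k).mulVec x := by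
    intro k x
    rw [← Matrix.toLin'_pow, Matrix.toLin'_apply]
  obtain ⟨N₀, h⟩ := card_zeros_le (Matrix.toLin' A) (Matrix.toLin' C)
    (by rw [Matrix.spectrum_toLin']; exact hcyc.pow_ne)
    (fun μ z hz hC => hAC.eq_zero (by simpa using hz) (by simpa using hC)) hδ
  -- With `N` at least the dimension, `A ^ N x ≠ 0` ensures that the trajectory of `x` never dies,
  -- so a singular `A` does no harm.
  refine ⟨max N₀ (Module.finrank ℂ (Fin m → ℂ)), fun N hN R hR hdet => ?_⟩
  by_contra hcard
  refine hdet (determines_of_forall fun x hx => ?_)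
  by_contra hne
  refine hcard (h N (le_of_max_le_left hN) x (fun h0 => hne ?_) R hR fun k hk => ?_)
  · rw [← hpow, ← Nat.sub_add_cancel (le_of_max_le_right hN), pow_add, Module.End.mul_apply, h0,
      map_zero]
  · rw [hpow, Matrix.toLin'_apply]
    exact hx k hk

end Matrix

/-! ### The threshold, growth of powers, and rarity of undetermined blocks. -/

theorem ofReal_lt_one_div_enorm_sq_iff (p : ℝ) (z : ℂ) :
    ENNReal.ofReal p < 1 / ‖z‖ₑ ^ 2 ↔ p * ‖z‖ ^ 2 < 1 := by
  by_cases hz : z = 0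
  · simp [hz]
  · have hz' : 0 < ‖z‖ ^ 2 := by positivity
    rw [← ofReal_norm, ← ENNReal.ofReal_pow (norm_nonneg z), ← ENNReal.ofReal_one,
      ← ENNReal.ofReal_div_of_pos hz', ENNReal.ofReal_lt_ofReal_iff (by positivity),
      lt_div_iff₀ hz']

section
open scoped Matrix.Norms.Operator

/-- Gelfand's formula for the spectral radius. -/
theorem eventually_norm_pow_mulVec_le {m : ℕ} {A : Matrix (Fin m) (Fin m) ℂ} {r ρ : ℝ}
    (hr : ∀ μ ∈ spectrum ℂ A, ‖μ‖ ≤ r) (hr0 : 0 ≤ r) (hρ : r < ρ) :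
    ∀ᶠ N : ℕ in Filter.atTop, ∀ v : Fin m → ℂ, ‖(A ^ N).mulVec v‖ ≤ ρ ^ N * ‖v‖ := by
  have hρ0 : 0 < ρ := hr0.trans_lt hρ
  have hrad : spectralRadius ℂ A < ENNReal.ofReal ρ := by
    refine lt_of_le_of_lt (iSup₂_le fun μ hμ => ?_) ((ENNReal.ofReal_lt_ofReal_iff hρ0).2 hρ)
    rw [← enorm_eq_nnnorm, ← ofReal_norm]
    exact ENNReal.ofReal_le_ofReal (hr μ hμ)
  have h := (spectrum.pow_nnnorm_pow_one_div_tendsto_nhds_spectralRadius A).eventually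
    (gt_mem_nhds hrad)
  filter_upwards [h, Filter.eventually_ge_atTop 1] with N hN hN1 v
  refine (Matrix.linfty_opNorm_mulVec _ _).trans ?_
  gcongr
  have hN0 : (N : ℝ) ≠ 0 := by exact_mod_cast (by omega : N ≠ 0)
  have h2 := ENNReal.rpow_le_rpow hN.le (Nat.cast_nonneg (α := ℝ) N)
  rw [← ENNReal.rpow_mul, one_div_mul_cancel hN0, ENNReal.rpow_one, ENNReal.rpow_natCast,
    ← enorm_eq_nnnorm, ← ofReal_norm, ← ENNReal.ofReal_pow hρ0.le,
    ENNReal.ofReal_le_ofReal_iff (by positivity)] at h2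
  exact h2

end

/-- The probability that the observations received in a block of length `N` do not determine the
state at the end of the block. -/
noncomputable def undeterminedProb {m l : ℕ} (A : Matrix (Fin m) (Fin m) ℂ)
    (C : Matrix (Fin l) (Fin m) ℂ) (p : ℝ) (N : ℕ) : ℝ :=
  open Classical in ∑ R ∈ (Finset.range N).powerset with ¬ Determines A C N R,
    (1 - p) ^ R.card * p ^ (N - R.card)

-- A Chernoff bound. A set `R` that does not determine the state has at most `δ * N` elements, so
-- the weight `s ^ (R.card - δ * N)` is at least `1` for `0 < s < 1`; inserting it gives a binomial
-- sum, bounded by `(s ^ (-δ) * ((1 - p) * s + p)) ^ N`. Since `p * r ^ 2 < 1`, continuity allows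
-- choosing `ρ` near `r`, then `s` near `0`, then `δ` near `0`, with `t < 1`.
open Filter Topology in
theorem exists_undeterminedProb_mul_le {m l : ℕ} {A : Matrix (Fin m) (Fin m) ℂ}
    {C : Matrix (Fin l) (Fin m) ℂ} (hAC : IsObservable A C) (hcyc : NoEigenvalueCycles A)
    {p r : ℝ} (hp0 : 0 ≤ p) (hp1 : p ≤ 1) (hr : ∀ μ ∈ spectrum ℂ A, ‖μ‖ ≤ r) (hr0 : 0 ≤ r)
    (hpr : p * r ^ 2 < 1) :
    ∃ N : ℕ, 1 ≤ N ∧ ∃ α : ℝ, (∀ v : Fin m → ℂ, ‖(A ^ N).mulVec v‖ ≤ α * ‖v‖) ∧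
      2 * α ^ 2 * undeterminedProb A C p N ≤ 1 / 2 := by
  classical
  obtain ⟨ρ, hρ, hrρ⟩ : ∃ ρ : ℝ, p * ρ ^ 2 < 1 ∧ r < ρ := by
    have hc : Continuous fun ρ : ℝ => p * ρ ^ 2 := by fun_prop
    exact (((hc.tendsto r).eventually (gt_mem_nhds hpr)).filter_mono nhdsWithin_le_nhds |>.and
      (self_mem_nhdsWithin : Set.Ioi r ∈ 𝓝[>] r)).exists
  have hρ0 : 0 < ρ := hr0.trans_lt hrρ
  obtain ⟨s, hs, hs1, hs0⟩ : ∃ s : ℝ, ((1 - p) * s + p) * ρ ^ 2 < 1 ∧ s < 1 ∧ 0 < s := by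
    have hc : Continuous fun s : ℝ => ((1 - p) * s + p) * ρ ^ 2 := by fun_prop
    have h1 := (hc.tendsto 0).eventually_lt_const (u := 1) (by simpa using hρ)
    exact ((h1.and (gt_mem_nhds one_pos)).filter_mono nhdsWithin_le_nhds |>.and
      (self_mem_nhdsWithin : Set.Ioi (0 : ℝ) ∈ 𝓝[>] 0)).exists.imp fun s h => ⟨h.1.1, h.1.2, h.2⟩
  have hq0 : 0 ≤ (1 - p) * s + p := by nlinarith
  obtain ⟨δ, hδ, hδ0⟩ : ∃ δ : ℝ, s ^ (-δ) * (((1 - p) * s + p) * ρ ^ 2) < 1 ∧ 0 < δ := by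
    have hc : Continuous fun δ : ℝ => s ^ (-δ) * (((1 - p) * s + p) * ρ ^ 2) :=
      ((Real.continuous_const_rpow hs0.ne').comp continuous_neg).mul continuous_const
    exact (((hc.tendsto 0).eventually_lt_const (u := 1) (by simpa using hs)).filter_mono
      nhdsWithin_le_nhds |>.and (self_mem_nhdsWithin : Set.Ioi (0 : ℝ) ∈ 𝓝[>] 0)).exists
  set t := s ^ (-δ) * (((1 - p) * s + p) * ρ ^ 2) with ht
  have ht0 : 0 ≤ t := by positivity
  obtain ⟨N₀, hN₀⟩ := card_le_of_not_determines hAC hcyc hδ0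
  have htend := (tendsto_pow_atTop_nhds_zero_of_lt_one ht0 hδ).eventually_lt_const
    (u := (1 / 4 : ℝ)) (by norm_num)
  obtain ⟨N, h1, h2, h3, h4⟩ := (htend.and ((eventually_norm_pow_mulVec_le hr hr0 hrρ).and
    ((eventually_ge_atTop N₀).and (eventually_ge_atTop 1)))).exists
  refine ⟨N, h4, ρ ^ N, h2, ?_⟩
  have hQ : undeterminedProb A C p N ≤ (s ^ (-δ)) ^ N * ((1 - p) * s + p) ^ N := by
    have hbin := Finset.sum_pow_mul_eq_add_pow ((1 - p) * s) p (Finset.range N)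
    rw [Finset.card_range] at hbin
    rw [← hbin, Finset.mul_sum, undeterminedProb]
    refine (Finset.sum_le_sum fun R hR => ?_).trans (Finset.sum_le_sum_of_subset_of_nonneg
      (Finset.filter_subset _ _) fun R _ _ => ?_)
    · rw [Finset.mem_filter, Finset.mem_powerset] at hR
      have hcard := hN₀ N h3 R hR.1 hR.2
      have hone : 1 ≤ (s ^ (-δ)) ^ N * s ^ R.card := by
        rw [← Real.rpow_natCast (s ^ (-δ)), ← Real.rpow_mul hs0.le, ← Real.rpow_natCast s,
          ← Real.rpow_add hs0]
        exact Real.one_le_rpow_of_pos_of_le_one_of_nonpos hs0 hs1.le (by linarith)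
      calc (1 - p) ^ R.card * p ^ (N - R.card)
          ≤ ((s ^ (-δ)) ^ N * s ^ R.card) * ((1 - p) ^ R.card * p ^ (N - R.card)) := by
            refine le_mul_of_one_le_left ?_ hone
            have : 0 ≤ 1 - p := by linarith
            positivity
        _ = _ := by rw [mul_pow]; ring
    · have : 0 ≤ 1 - p := by linarith
      positivity
  calc 2 * (ρ ^ N) ^ 2 * undeterminedProb A C p N
      ≤ 2 * (ρ ^ N) ^ 2 * ((s ^ (-δ)) ^ N * ((1 - p) * s + p) ^ N) := by gcongr
    _ = 2 * t ^ N := by rw [ht, mul_pow, mul_pow, ← pow_mul, ← pow_mul, mul_comm N 2]; ring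
    _ ≤ 1 / 2 := by linarith

/-! ### Second moments and Gaussian vectors. -/

section SecondMoment

variable {Ω : Type*} [MeasurableSpace Ω] {P : Measure Ω}

theorem MeasureTheory.MemLp.lintegral_enorm_sq [IsFiniteMeasure P] {Z : Ω → ℂ}
    (hZ : MemLp Z 2 P) :
    ∫⁻ ω, ‖Z ω‖ₑ ^ 2 ∂P = ENNReal.ofReal (∫ ω, ‖Z ω‖ ^ 2 ∂P) := by
  rw [ofReal_integral_eq_lintegral_ofReal hZ.integrable_norm_pow'
    (ae_of_all _ fun ω => by positivity)]
  simp_rw [ENNReal.ofReal_pow (norm_nonneg _), ofReal_norm]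

/-- Square-integrable independent variables, one of them centred, are orthogonal; the other one
need not be assumed square-integrable. -/
theorem lintegral_enorm_sq_add_le {G X : Ω → ℂ} [IsProbabilityMeasure P] (hG : Measurable G)
    (hX : MemLp X 2 P) (hind : IndepFun G X P) (hmean : ∫ ω, X ω ∂P = 0) :
    ∫⁻ ω, ‖G ω‖ₑ ^ 2 ∂P + ∫⁻ ω, ‖X ω‖ₑ ^ 2 ∂P ≤ ∫⁻ ω, ‖G ω + X ω‖ₑ ^ 2 ∂P := by
  -- An arbitrary estimator may have infinite error. If the sum is square-integrable, then so is
  -- `G`, as its difference with `X`.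
  by_cases htop : ∫⁻ ω, ‖G ω + X ω‖ₑ ^ 2 ∂P = ⊤
  · rw [htop]; exact le_top
  have hGX : MemLp (fun ω => G ω + X ω) 2 P := by
    refine ⟨hG.aestronglyMeasurable.add hX.1, ?_⟩
    rw [eLpNorm_lt_top_iff_lintegral_rpow_enorm_lt_top (by norm_num) (by norm_num)]
    simpa using lt_top_iff_ne_top.2 htop
  have hG2 : MemLp G 2 P := by
    have h := hGX.sub hX
    rwa [show (fun ω => G ω + X ω) - X = G from funext fun ω => add_sub_cancel_right _ _] at h
  rw [hG2.lintegral_enorm_sq, hX.lintegral_enorm_sq, hGX.lintegral_enorm_sq,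
    ← ENNReal.ofReal_add (by positivity) (by positivity)]
  refine ENNReal.ofReal_le_ofReal (le_of_eq ?_)
  have hconj : ∫ ω, star (X ω) ∂P = 0 := by
    have := integral_conj (μ := P) (f := X)
    simp only [hmean, map_zero] at this
    exact this
  have hXs : MemLp (fun ω => star (X ω)) 2 P := hX.star
  have hind' : IndepFun G (fun ω => star (X ω)) P :=
    hind.comp (φ := id) (ψ := fun z : ℂ => star z) measurable_id continuous_star.measurable
  have hcross : ∫ ω, G ω * star (X ω) ∂P = 0 := by
    rw [hind'.integral_fun_mul_eq_mul_integral hG2.1 hXs.1, hconj, mul_zero]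
  have hint : Integrable (fun ω => G ω * star (X ω)) P := hG2.integrable_mul hXs
  have hre : ∫ ω, (G ω * star (X ω)).re ∂P = 0 := by
    have := integral_re hint
    simp only [hcross, map_zero] at this
    exact this
  have hexp : ∀ ω, ‖G ω + X ω‖ ^ 2 = ‖G ω‖ ^ 2 + ‖X ω‖ ^ 2 + 2 * (G ω * star (X ω)).re := by
    intro ω
    rw [← Complex.normSq_eq_norm_sq, ← Complex.normSq_eq_norm_sq, ← Complex.normSq_eq_norm_sq,
      Complex.normSq_add]
    rfl
  simp_rw [hexp]
  have hi₁ : Integrable (fun ω => ‖G ω‖ ^ 2) P := hG2.integrable_norm_pow'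
  have hi₂ : Integrable (fun ω => ‖X ω‖ ^ 2) P := hX.integrable_norm_pow'
  have hi₃ : Integrable (fun ω => (G ω * star (X ω)).re) P := hint.re
  have hi₁₂ : Integrable (fun ω => ‖G ω‖ ^ 2 + ‖X ω‖ ^ 2) P := hi₁.add hi₂
  rw [integral_add hi₁₂ (hi₃.const_mul 2), integral_add hi₁ hi₂, integral_const_mul, hre,
    mul_zero, add_zero]

variable {k : ℕ} {X : Ω → Fin k → ℂ}

theorem ProbabilityTheory.HasGaussianLaw.memLp_dotProduct (hX : HasGaussianLaw X P)
    (q : Fin k → ℂ) : MemLp (fun ω => q ⬝ᵥ X ω) 2 P := by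
  have h := fun i => (hX.memLp_two).eval i
  exact memLp_finsetSum _ fun i _ => (h i).const_mul (q i)

theorem star_dotProduct_secondMoment_mulVec (hX : HasGaussianLaw X P) (z : Fin k → ℂ) :
    star z ⬝ᵥ (secondMoment P X).mulVec z = ((∫ ω, ‖star z ⬝ᵥ X ω‖ ^ 2 ∂P : ℝ) : ℂ) := by
  have h := fun i => (hX.memLp_two).eval i
  have hint : ∀ i j, Integrable (fun ω => X ω i * star (X ω j)) P :=
    fun i j => (h i).integrable_mul (h j).star
  have hexp : ∀ ω, ((‖star z ⬝ᵥ X ω‖ ^ 2 : ℝ) : ℂ)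
      = ∑ i, ∑ j, star (z i) * z j * (X ω i * star (X ω j)) := by
    intro ω
    rw [← Complex.normSq_eq_norm_sq, Complex.normSq_eq_conj_mul_self, mul_comm, dotProduct,
      map_sum, Finset.sum_mul_sum]
    refine Finset.sum_congr rfl fun i _ => Finset.sum_congr rfl fun j _ => ?_
    simp
    ring
  rw [← integral_complex_ofReal]
  simp_rw [hexp]
  rw [integral_finsetSum _ fun i _ => integrable_finsetSum _ fun j _ => (hint i j).const_mul _]
  simp only [dotProduct, Matrix.mulVec]
  refine Finset.sum_congr rfl fun i _ => ?_
  rw [integral_finsetSum _ fun j _ => (hint i j).const_mul _, Finset.mul_sum]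
  refine Finset.sum_congr rfl fun j _ => ?_
  rw [integral_const_mul, secondMoment, Matrix.of_apply, Pi.star_apply]
  ring

theorem star_dotProduct_smul_one_mulVec (c : ℝ) (z : Fin k → ℂ) :
    star z ⬝ᵥ (((c : ℂ) ^ 2) • (1 : Matrix (Fin k) (Fin k) ℂ)).mulVec z
      = ((c ^ 2 * ∑ i, ‖z i‖ ^ 2 : ℝ) : ℂ) := by
  rw [Matrix.smul_mulVec, Matrix.one_mulVec, dotProduct_smul, smul_eq_mul, dotProduct]
  push_cast
  congr 1
  refine Finset.sum_congr rfl fun i _ => ?_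
  rw [Pi.star_apply, ← Complex.conj_mul']
  rfl

theorem integral_norm_sq_dotProduct_le {σ : ℝ} (hX : HasGaussianLaw X P)
    (h : (((σ : ℂ) ^ 2) • (1 : Matrix (Fin k) (Fin k) ℂ) - secondMoment P X).PosSemidef)
    (q : Fin k → ℂ) : ∫ ω, ‖q ⬝ᵥ X ω‖ ^ 2 ∂P ≤ σ ^ 2 * ∑ i, ‖q i‖ ^ 2 := by
  have h1 := h.dotProduct_mulVec_nonneg (star q)
  rw [Matrix.sub_mulVec, dotProduct_sub, star_dotProduct_secondMoment_mulVec hX,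
    star_dotProduct_smul_one_mulVec, star_star, ← Complex.ofReal_sub, Complex.zero_le_real] at h1
  simpa using h1

theorem le_integral_norm_sq_dotProduct {σ : ℝ} (hX : HasGaussianLaw X P)
    (h : (secondMoment P X - ((σ : ℂ) ^ 2) • (1 : Matrix (Fin k) (Fin k) ℂ)).PosSemidef)
    (q : Fin k → ℂ) : σ ^ 2 * ∑ i, ‖q i‖ ^ 2 ≤ ∫ ω, ‖q ⬝ᵥ X ω‖ ^ 2 ∂P := by
  have h1 := h.dotProduct_mulVec_nonneg (star q)
  rw [Matrix.sub_mulVec, dotProduct_sub, star_dotProduct_secondMoment_mulVec hX,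
    star_dotProduct_smul_one_mulVec, star_star, ← Complex.ofReal_sub, Complex.zero_le_real] at h1
  simpa using h1

theorem lintegral_enorm_sq_le [IsFiniteMeasure P] {σ : ℝ} (hX : HasGaussianLaw X P)
    (h : (((σ : ℂ) ^ 2) • (1 : Matrix (Fin k) (Fin k) ℂ) - secondMoment P X).PosSemidef) :
    ∫⁻ ω, ‖X ω‖ₑ ^ 2 ∂P ≤ k * ENNReal.ofReal (σ ^ 2) := by
  have h1 : ∀ i, ∫⁻ ω, ‖X ω i‖ₑ ^ 2 ∂P ≤ ENNReal.ofReal (σ ^ 2) := by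
    intro i
    have hq := integral_norm_sq_dotProduct_le hX h (Pi.single i 1)
    rw [((hX.memLp_two).eval i).lintegral_enorm_sq]
    refine ENNReal.ofReal_le_ofReal ?_
    simpa [Pi.single_apply, apply_ite, ite_pow] using hq
  have h2 : ∀ ω, ‖X ω‖ₑ ^ 2 ≤ ∑ i, ‖X ω i‖ₑ ^ 2 := by
    intro ω
    have hr : ‖X ω‖ ^ 2 ≤ ∑ i, ‖X ω i‖ ^ 2 := by
      rw [← Real.le_sqrt (norm_nonneg _) (by positivity), pi_norm_le_iff_of_nonneg (by positivity)]
      intro i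
      refine Real.le_sqrt_of_sq_le ?_
      exact Finset.single_le_sum (f := fun i => ‖X ω i‖ ^ 2) (fun i _ => by positivity)
        (Finset.mem_univ i)
    have := ENNReal.ofReal_le_ofReal hr
    rw [ENNReal.ofReal_sum_of_nonneg (fun i _ => by positivity)] at this
    simpa [ENNReal.ofReal_pow, ofReal_norm] using this
  calc ∫⁻ ω, ‖X ω‖ₑ ^ 2 ∂P ≤ ∫⁻ ω, ∑ i, ‖X ω i‖ₑ ^ 2 ∂P := lintegral_mono h2
    _ = ∑ i, ∫⁻ ω, ‖X ω i‖ₑ ^ 2 ∂P := lintegral_finsetSum' _ fun i _ =>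
        (((hX.memLp_two).eval i).1.enorm.pow_const 2)
    _ ≤ ∑ _i : Fin k, ENNReal.ofReal (σ ^ 2) := Finset.sum_le_sum fun i _ => h1 i
    _ = _ := by simp

/-- A real Gaussian variable that is not constant avoids any independent variable. -/
theorem measure_add_eq_zero_of_variance_ne_zero [IsProbabilityMeasure P] {U V : Ω → ℝ}
    (hU : Measurable U) (hVm : Measurable V) (hV : HasGaussianLaw V P) (hind : IndepFun U V P)
    (hvar : Var[V; P] ≠ 0) : P {ω | U ω + V ω = 0} = 0 := by
  have hna : NullSingletonClass (P.map V) := by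
    rw [hV.map_eq_gaussianReal]
    refine nullSingletonClass_gaussianReal ?_
    rw [Ne, Real.toNNReal_eq_zero, not_le]
    exact lt_of_le_of_ne (variance_nonneg _ _) hvar.symm
  have hms : MeasurableSet {p : ℝ × ℝ | p.1 + p.2 = 0} :=
    measurableSet_eq_fun (by fun_prop) measurable_const
  have h1 : {ω | U ω + V ω = 0} = (fun ω => (U ω, V ω)) ⁻¹' {p : ℝ × ℝ | p.1 + p.2 = 0} := rfl
  rw [h1, ← Measure.map_apply (hU.prodMk hVm) hms,
    (indepFun_iff_map_prod_eq_prod_map_map hU.aemeasurable hVm.aemeasurable).1 hind,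
    Measure.prod_apply hms]
  have : IsProbabilityMeasure (P.map V) := Measure.isProbabilityMeasure_map hVm.aemeasurable
  have h2 : ∀ a : ℝ, P.map V (Prod.mk a ⁻¹' {p : ℝ × ℝ | p.1 + p.2 = 0}) = 0 := by
    intro a
    have : Prod.mk a ⁻¹' {p : ℝ × ℝ | p.1 + p.2 = 0} = {-a} := by
      ext b
      simp [add_eq_zero_iff_neg_eq, eq_comm]
    rw [this]
    exact measure_singleton _
  simp_rw [h2, lintegral_zero]

/-- A centred Gaussian vector with nondegenerate second moments avoids any independent vector. -/
theorem measure_add_eq_zero_of_posSemidef [IsProbabilityMeasure P] {σ : ℝ} (hσ : 0 < σ)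
    {Y : Ω → Fin k → ℂ} (hk : 0 < k) (hY : Measurable Y) (hXm : Measurable X)
    (hX : HasGaussianLaw X P) (hind : IndepFun Y X P) (hmean : ∫ ω, X ω ∂P = 0)
    (h : (secondMoment P X - ((σ : ℂ) ^ 2) • (1 : Matrix (Fin k) (Fin k) ℂ)).PosSemidef) :
    P {ω | Y ω + X ω = 0} = 0 := by
  set i : Fin k := ⟨0, hk⟩
  let L₁ : (Fin k → ℂ) →L[ℝ] ℝ := Complex.reCLM ∘L (ContinuousLinearMap.proj i)
  let L₂ : (Fin k → ℂ) →L[ℝ] ℝ := Complex.imCLM ∘L (ContinuousLinearMap.proj i)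
  -- One nondegenerate real coordinate suffices. If the real and imaginary parts of entry `i` both
  -- had variance zero, its second moment could not be at least `σ ^ 2`.
  have key : ∀ L : (Fin k → ℂ) →L[ℝ] ℝ, Var[fun ω => L (X ω); P] ≠ 0 →
      P {ω | Y ω + X ω = 0} = 0 := by
    intro L hL
    refine measure_mono_null (fun ω hω => ?_) (measure_add_eq_zero_of_variance_ne_zero
      (L.measurable.comp hY) (L.measurable.comp hXm) (hX.map L)
      (hind.comp L.measurable L.measurable) hL)
    have := congrArg L (hω : Y ω + X ω = 0)
    simpa using this
  have hsq : ∀ L : (Fin k → ℂ) →L[ℝ] ℝ, Var[fun ω => L (X ω); P] = ∫ ω, (L (X ω)) ^ 2 ∂P := by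
    intro L
    refine variance_of_integral_eq_zero (L.measurable.comp hXm).aemeasurable ?_
    rw [L.integral_comp_comm hX.integrable, hmean, map_zero]
  by_contra hne
  have h1 : ∫ ω, (L₁ (X ω)) ^ 2 ∂P = 0 := by
    rw [← hsq]; by_contra hc; exact hne (key L₁ hc)
  have h2 : ∫ ω, (L₂ (X ω)) ^ 2 ∂P = 0 := by
    rw [← hsq]; by_contra hc; exact hne (key L₂ hc)
  have h3 := le_integral_norm_sq_dotProduct hX h (Pi.single i 1)
  have h4 : ∀ ω, ‖(Pi.single i 1 : Fin k → ℂ) ⬝ᵥ X ω‖ ^ 2 = (L₁ (X ω)) ^ 2 + (L₂ (X ω)) ^ 2 := by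
    intro ω
    rw [single_dotProduct, one_mul, ← Complex.normSq_eq_norm_sq, Complex.normSq_apply, sq, sq]
    rfl
  simp_rw [h4] at h3
  rw [integral_add ((hX.map_fun L₁).memLp_two.integrable_sq)
    ((hX.map_fun L₂).memLp_two.integrable_sq), h1, h2] at h3
  have h5 : ∑ j, ‖(Pi.single i 1 : Fin k → ℂ) j‖ ^ 2 = 1 := by
    simp [Pi.single_apply, apply_ite, ite_pow]
  rw [h5] at h3
  nlinarith

end SecondMoment

/-! ### Which inputs each signal depends on. -/

namespace IntermittentSystem

variable {m g l : ℕ} {A : Matrix (Fin m) (Fin m) ℂ} {B : Matrix (Fin m) (Fin g) ℂ}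
  {C : Matrix (Fin l) (Fin m) ℂ} {σ σ' pe : ℝ} {Ω : Type*} [MeasurableSpace Ω] {P : Measure Ω}
  (S : IntermittentSystem A B C σ σ' pe P)

/-- The `σ`-algebras generated by the independent inputs `x[0]`, `w[n]`, `v[n]`, `β[n]`. -/
noncomputable abbrev inputSigma : Unit ⊕ ℕ ⊕ ℕ ⊕ ℕ → MeasurableSpace Ω :=
  Sum.elim (fun _ : Unit => MeasurableSpace.comap (S.x 0) inferInstance)
    (Sum.elim (fun n : ℕ => MeasurableSpace.comap (S.w n) inferInstance)
      (Sum.elim (fun n : ℕ => MeasurableSpace.comap (S.v n) inferInstance)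
        (fun n : ℕ => MeasurableSpace.comap (S.β n) inferInstance)))

/-- The `σ`-algebra generated by the inputs with index in `T`. -/
@[irreducible]
noncomputable def info (T : Set (Unit ⊕ ℕ ⊕ ℕ ⊕ ℕ)) : MeasurableSpace Ω := ⨆ i ∈ T, S.inputSigma i

theorem inputSigma_le (i : Unit ⊕ ℕ ⊕ ℕ ⊕ ℕ) : S.inputSigma i ≤ ‹MeasurableSpace Ω› := by
  rcases i with _ | n | n | n
  · exact S.measurable_x0.comap_le
  · exact (S.measurable_w n).comap_le
  · exact (S.measurable_v n).comap_le
  · exact (S.measurable_β n).comap_le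

theorem info_le (T : Set (Unit ⊕ ℕ ⊕ ℕ ⊕ ℕ)) : S.info T ≤ ‹MeasurableSpace Ω› := by
  rw [info]
  exact iSup₂_le fun i _ => S.inputSigma_le i

theorem indep_info {T T' : Set (Unit ⊕ ℕ ⊕ ℕ ⊕ ℕ)} (h : Disjoint T T') :
    Indep (S.info T) (S.info T') P := by
  rw [info, info]
  exact indep_iSup_of_disjoint S.inputSigma_le S.indep h

theorem indepFun_of_measurable_info {α α' : Type*} [MeasurableSpace α] [MeasurableSpace α']
    {T T' : Set (Unit ⊕ ℕ ⊕ ℕ ⊕ ℕ)} (h : Disjoint T T') {f : Ω → α} {f' : Ω → α'}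
    (hf : Measurable[S.info T] f) (hf' : Measurable[S.info T'] f') : IndepFun f f' P := by
  rw [IndepFun_iff_Indep]
  exact indep_of_indep_of_le (S.indep_info h) hf.comap_le hf'.comap_le

theorem lintegral_indicator_one_mul_of_info {T T' : Set (Unit ⊕ ℕ ⊕ ℕ ⊕ ℕ)} (h : Disjoint T T')
    {E : Set Ω} (hE : MeasurableSet[S.info T] E) {F : Ω → ENNReal} (hF : Measurable[S.info T'] F) :
    ∫⁻ ω, E.indicator 1 ω * F ω ∂P = P E * ∫⁻ ω, F ω ∂P := by
  have hE' : Measurable[S.info T] (E.indicator (1 : Ω → ENNReal)) :=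
    Measurable.indicator (@measurable_const _ _ _ (S.info T) 1) hE
  rw [lintegral_mul_eq_lintegral_mul_lintegral_of_independent_measurableSpace
    (S.info_le T) (S.info_le T') (S.indep_info h) hE' hF,
    lintegral_indicator_one (S.info_le T _ hE)]

variable {T : Set (Unit ⊕ ℕ ⊕ ℕ ⊕ ℕ)}

theorem measurable_info_of_mem {α : Type*} [MeasurableSpace α] {i : Unit ⊕ ℕ ⊕ ℕ ⊕ ℕ} (hi : i ∈ T)
    {f : Ω → α} (hf : Measurable[S.inputSigma i] f) : Measurable[S.info T] f := by
  rw [info]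
  exact hf.mono (le_iSup₂ (f := fun i (_ : i ∈ T) => S.inputSigma i) i hi) le_rfl

theorem measurable_info_w {n : ℕ} (h : .inr (.inl n) ∈ T) : Measurable[S.info T] (S.w n) :=
  S.measurable_info_of_mem h (comap_measurable _)

theorem measurable_info_v {n : ℕ} (h : .inr (.inr (.inl n)) ∈ T) : Measurable[S.info T] (S.v n) :=
  S.measurable_info_of_mem h (comap_measurable _)

theorem measurable_info_β {n : ℕ} (h : .inr (.inr (.inr n)) ∈ T) : Measurable[S.info T] (S.β n) :=
  S.measurable_info_of_mem h (comap_measurable _)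

theorem measurable_info_x (h0 : .inl () ∈ T) {n : ℕ} (hw : ∀ i < n, .inr (.inl i) ∈ T) :
    Measurable[S.info T] (S.x n) := by
  induction n with
  | zero => exact S.measurable_info_of_mem h0 (comap_measurable _)
  | succ n ih =>
    have h1 := ih fun i hi => hw i (hi.trans n.lt_succ_self)
    have h2 := S.measurable_info_w (hw n n.lt_succ_self)
    have hA : Measurable fun v : Fin m → ℂ => A.mulVec v :=
      (Continuous.matrix_mulVec continuous_const continuous_id).measurable
    have hB : Measurable fun v : Fin g → ℂ => B.mulVec v :=
      (Continuous.matrix_mulVec continuous_const continuous_id).measurable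
    rw [show S.x (n + 1) = fun ω => A.mulVec (S.x n ω) + B.mulVec (S.w n ω) from
      funext (S.state_eq n)]
    exact (hA.comp h1).add (hB.comp h2)

theorem measurable_info_y (h0 : .inl () ∈ T) {n : ℕ} (hw : ∀ i < n, .inr (.inl i) ∈ T)
    (hv : .inr (.inr (.inl n)) ∈ T) (hβ : .inr (.inr (.inr n)) ∈ T) :
    Measurable[S.info T] (S.y n) := by
  have h1 := S.measurable_info_x h0 hw
  have h2 := S.measurable_info_v hv
  have h3 := S.measurable_info_β hβ
  have hC : Measurable fun v : Fin m → ℂ => C.mulVec v :=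
    (Continuous.matrix_mulVec continuous_const continuous_id).measurable
  rw [show S.y n = fun ω => (S.β n ω : ℂ) • (C.mulVec (S.x n ω) + S.v n ω) from
    funext (S.obs_eq n)]
  exact (Complex.measurable_ofReal.comp h3).smul ((hC.comp h1).add h2)

theorem measurable_x (n : ℕ) : Measurable (S.x n) :=
  (S.measurable_info_x (T := Set.univ) trivial fun _ _ => trivial).mono (S.info_le _) le_rfl

end IntermittentSystem

/-! ### Necessity of the threshold. -/

theorem enorm_sq_dotProduct_le {m : ℕ} (u e : Fin m → ℂ) :
    ‖u ⬝ᵥ e‖ₑ ^ 2 ≤ ENNReal.ofReal (∑ i, ‖u i‖ ^ 2) * ∑ i, ‖e i‖ₑ ^ 2 := by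
  have h1 : ‖u ⬝ᵥ e‖ ^ 2 ≤ (∑ i, ‖u i‖ ^ 2) * ∑ i, ‖e i‖ ^ 2 := by
    refine le_trans ?_ (Finset.sum_mul_sq_le_sq_mul_sq _ _ _)
    gcongr
    exact (norm_sum_le _ _).trans_eq (Finset.sum_congr rfl fun i _ => norm_mul _ _)
  have h2 := ENNReal.ofReal_le_ofReal h1
  rw [ENNReal.ofReal_mul (by positivity), ENNReal.ofReal_pow (norm_nonneg _), ofReal_norm,
    ENNReal.ofReal_sum_of_nonneg (f := fun i => ‖e i‖ ^ 2) (fun i _ => by positivity)] at h2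
  simpa [ENNReal.ofReal_pow, ofReal_norm] using h2

namespace IntermittentSystem

variable {m g l : ℕ} {A : Matrix (Fin m) (Fin m) ℂ} {B : Matrix (Fin m) (Fin g) ℂ}
  {C : Matrix (Fin l) (Fin m) ℂ} {σ σ' pe : ℝ} {Ω : Type*} [MeasurableSpace Ω] {P : Measure Ω}
  (S : IntermittentSystem A B C σ σ' pe P)

theorem erasure_nonneg (S : IntermittentSystem A B C σ σ' pe P) : 0 ≤ pe := by
  rw [← S.prob_erased 0]; exact measureReal_nonneg

theorem erasure_le_one [IsProbabilityMeasure P] (S : IntermittentSystem A B C σ σ' pe P) :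
    pe ≤ 1 := by
  rw [← S.prob_erased 0]; exact measureReal_le_one

theorem measure_erased [IsProbabilityMeasure P] (n : ℕ) :
    P {ω | S.β n ω = 0} = ENNReal.ofReal pe :=
  (ofReal_measureReal (measure_ne_top P _)).symm.trans (congrArg ENNReal.ofReal (S.prob_erased n))

/-- Along a left eigenvector of `A` for an eigenvalue `a` with `1 ≤ pe * ‖a‖ ^ 2`, the mean square
error of any causal estimator grows at least linearly. -/
theorem le_lintegral_enorm_sq_sub [IsProbabilityMeasure P] {a : ℂ} {u : Fin m → ℂ}
    (hu : Matrix.vecMul u A = a • u) (ha : a ≠ 0) (hpe : 1 ≤ pe * ‖a‖ ^ 2) (n : ℕ)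
    (h : (Fin (n + 1) → Fin l → ℂ) → ℂ) (hh : Measurable h) :
    ENNReal.ofReal (n * (pe * (σ' ^ 2 * ∑ i, ‖Matrix.vecMul u B i‖ ^ 2)))
      ≤ ∫⁻ ω, ‖u ⬝ᵥ S.x n ω - h (fun k => S.y k ω)‖ₑ ^ 2 ∂P := by
  have hpe0 := S.erasure_nonneg
  set q := Matrix.vecMul u B with hq
  set c := σ' ^ 2 * ∑ i, ‖q i‖ ^ 2 with hc
  have hc0 : 0 ≤ c := by positivity
  induction n with
  | zero => simp
  | succ n ih =>
    have hdot : ∀ {k : ℕ} (z : Fin k → ℂ), Measurable fun v : Fin k → ℂ => z ⬝ᵥ v :=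
      fun z => (Continuous.dotProduct continuous_const continuous_id).measurable
    -- Padding by zero reproduces the observations exactly when the packet at time `n + 1` is
    -- erased, since `y` is then `0`.
    let ext : (Fin (n + 1) → Fin l → ℂ) → Fin (n + 1 + 1) → Fin l → ℂ :=
      fun z k => if hk : (k : ℕ) < n + 1 then z ⟨k, hk⟩ else 0
    have hext : Measurable ext := by
      refine measurable_pi_iff.2 fun k => ?_
      change Measurable fun z : Fin (n + 1) → Fin l → ℂ =>
        if hk : (k : ℕ) < n + 1 then z ⟨k, hk⟩ else 0
      split_ifs
      · exact measurable_pi_apply _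
      · exact measurable_const
    let past : Ω → Fin (n + 1) → Fin l → ℂ := fun ω k => S.y k ω
    let G : Ω → ℂ := fun ω => a * (u ⬝ᵥ S.x n ω) - h (ext (past ω))
    let X : Ω → ℂ := fun ω => q ⬝ᵥ S.w n ω
    have hrec : ∀ ω, u ⬝ᵥ S.x (n + 1) ω = a * (u ⬝ᵥ S.x n ω) + X ω := by
      intro ω
      rw [S.state_eq, dotProduct_add, Matrix.dotProduct_mulVec, Matrix.dotProduct_mulVec, hu,
        smul_dotProduct, smul_eq_mul]
    have hGm : ∀ T : Set (Unit ⊕ ℕ ⊕ ℕ ⊕ ℕ), .inl () ∈ T → (∀ i < n, .inr (.inl i) ∈ T) →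
        (∀ i ≤ n, .inr (.inr (.inl i)) ∈ T) → (∀ i ≤ n, .inr (.inr (.inr i)) ∈ T) →
        Measurable[S.info T] G := by
      intro T h0 hw hv hβ
      have hx := S.measurable_info_x h0 hw
      have hp : Measurable[S.info T] past := by
        refine @measurable_pi_lambda _ _ _ (S.info T) _ _ fun k => S.measurable_info_y h0 (fun i hi => hw i ?_)
          (hv k ?_) (hβ k ?_) <;> omega
      exact (((hdot u).comp hx).const_mul a).sub (hh.comp (hext.comp hp))
    have hXm : ∀ T : Set (Unit ⊕ ℕ ⊕ ℕ ⊕ ℕ), .inr (.inl n) ∈ T → Measurable[S.info T] X :=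
      fun T hT => (hdot q).comp (S.measurable_info_w hT)
    have hGX : ENNReal.ofReal (‖a‖ ^ 2 * (n * (pe * c)) + c) ≤ ∫⁻ ω, ‖G ω + X ω‖ₑ ^ 2 ∂P := by
      have hind : IndepFun G X P := by
        refine S.indepFun_of_measurable_info
          (T := {.inr (.inl n)}ᶜ) (T' := {.inr (.inl n)}) disjoint_compl_left (hGm _ ?_ ?_ ?_ ?_)
          (hXm _ rfl) <;> simp
        omega
      have hGmeas : Measurable G :=
        (hGm Set.univ trivial (fun _ _ => trivial) (fun _ _ => trivial)
          (fun _ _ => trivial)).mono (S.info_le _) le_rfl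
      have hX2 : MemLp X 2 P := (S.gaussian_w n).memLp_dotProduct q
      have hmean : ∫ ω, X ω ∂P = 0 := by
        simp only [X, dotProduct]
        have hwi : ∀ i, Integrable (fun ω => S.w n ω i) P :=
          fun i => (((S.gaussian_w n).memLp_two).eval i).integrable (by norm_num)
        rw [integral_finsetSum _ fun i _ => (hwi i).const_mul _]
        refine Finset.sum_eq_zero fun i _ => ?_
        rw [integral_const_mul, ← eval_integral hwi, S.mean_w n, Pi.zero_apply, mul_zero]
      refine le_trans ?_ (lintegral_enorm_sq_add_le hGmeas hX2 hind hmean)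
      rw [ENNReal.ofReal_add (by positivity) hc0, ENNReal.ofReal_mul (by positivity),
        ENNReal.ofReal_pow (norm_nonneg _), ofReal_norm]
      refine add_le_add ?_ ?_
      -- `a⁻¹ * h ∘ ext` is a causal estimator of `u ⬝ᵥ x[n]`, so the induction hypothesis must
      -- range over all `h`.
      · have h1 := ih (fun z => a⁻¹ * h (ext z)) ((hh.comp hext).const_mul _)
        have h2 : ∀ ω, ‖G ω‖ₑ ^ 2 = ‖a‖ₑ ^ 2 * ‖u ⬝ᵥ S.x n ω - a⁻¹ * h (ext (past ω))‖ₑ ^ 2 := by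
          intro ω
          rw [← mul_pow, ← enorm_mul, mul_sub, mul_inv_cancel_left₀ ha]
        simp_rw [h2]
        rw [lintegral_const_mul' _ _ (by simp)]
        gcongr
      · rw [hX2.lintegral_enorm_sq]
        exact ENNReal.ofReal_le_ofReal
          (le_integral_norm_sq_dotProduct (S.gaussian_w n) (S.lower_w n) q)
    set E : Set Ω := {ω | S.β (n + 1) ω = 0} with hE
    have hprod : ∫⁻ ω, E.indicator 1 ω * ‖G ω + X ω‖ₑ ^ 2 ∂P
        = ENNReal.ofReal pe * ∫⁻ ω, ‖G ω + X ω‖ₑ ^ 2 ∂P := by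
      have hEm : MeasurableSet[S.info {.inr (.inr (.inr (n + 1)))}] E :=
        S.measurable_info_β (Set.mem_singleton _) (measurableSet_singleton 0)
      have hGXm : Measurable[S.info {.inr (.inr (.inr (n + 1)))}ᶜ] fun ω => G ω + X ω := by
        refine (hGm _ ?_ ?_ ?_ ?_).add (hXm _ ?_) <;> simp
        omega
      have := S.lintegral_indicator_one_mul_of_info disjoint_compl_right hEm
        ((measurable_enorm.pow_const 2).comp hGXm)
      rwa [S.measure_erased] at this
    have hle : ∫⁻ ω, E.indicator 1 ω * ‖G ω + X ω‖ₑ ^ 2 ∂P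
        ≤ ∫⁻ ω, ‖u ⬝ᵥ S.x (n + 1) ω - h (fun k => S.y k ω)‖ₑ ^ 2 ∂P := by
      refine lintegral_mono fun ω => ?_
      by_cases hω : ω ∈ E
      · have hy : ext (past ω) = fun k : Fin (n + 1 + 1) => S.y k ω := by
          funext k
          by_cases hk : (k : ℕ) < n + 1
          · exact dif_pos hk
          · have hkn : (k : ℕ) = n + 1 := by omega
            have hβ0 : S.β (n + 1) ω = 0 := hω
            simp [ext, hkn, S.obs_eq, hβ0]
        simp only [Set.indicator_of_mem hω, Pi.one_apply, one_mul, G, hy, hrec]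
        rw [sub_add_eq_add_sub]
      · simp [hω]
    -- What remains is `pe * (‖a‖ ^ 2 * (n * (pe * c)) + c) ≥ (n + 1) * (pe * c)`, from `pe * ‖a‖ ^
    -- 2 ≥ 1`.
    refine le_trans ?_ (hprod ▸ hle)
    refine le_trans ?_ (mul_le_mul_right hGX _)
    rw [← ENNReal.ofReal_mul hpe0]
    refine ENNReal.ofReal_le_ofReal ?_
    push_cast
    have : 0 ≤ (n : ℝ) * (pe * c) := by positivity
    nlinarith

theorem lt_one_of_isIntermittentObservable [IsProbabilityMeasure P] (hσ' : 0 < σ')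
    (hAB : IsControllable A B) {a : ℂ} (ha : a ∈ spectrum ℂ A) (hS : S.IsIntermittentObservable) :
    pe * ‖a‖ ^ 2 < 1 := by
  by_contra! hpe
  have hpe0 : 0 < pe := by
    refine lt_of_le_of_ne S.erasure_nonneg fun h => ?_
    rw [← h, zero_mul] at hpe
    linarith
  have ha0 : a ≠ 0 := by
    rintro rfl
    norm_num at hpe
  obtain ⟨u, hu0, hu⟩ := exists_vecMul_eq_smul ha
  have hq : 0 < ∑ i, ‖Matrix.vecMul u B i‖ ^ 2 := by
    obtain ⟨i, hi⟩ := Function.ne_iff.1 (fun h => hu0 (hAB.eq_zero hu h))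
    refine Finset.sum_pos' (fun j _ => by positivity) ⟨i, Finset.mem_univ i, ?_⟩
    have := norm_pos_iff.2 hi
    positivity
  obtain ⟨f, hf, hsup⟩ := hS
  set K := ⨆ n : ℕ, ∫⁻ ω, (∑ i, ‖S.x n ω i - f n (fun k => S.y k ω) i‖ₑ ^ 2) ∂P with hK
  have hbound : ∀ n : ℕ, ENNReal.ofReal (n * (pe * (σ' ^ 2 * ∑ i, ‖Matrix.vecMul u B i‖ ^ 2)))
      ≤ ENNReal.ofReal (∑ i, ‖u i‖ ^ 2) * K := by
    intro n
    have hm : Measurable fun z => u ⬝ᵥ f n z :=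
      (Continuous.dotProduct continuous_const continuous_id).measurable.comp (hf n)
    refine (S.le_lintegral_enorm_sq_sub hu ha0 hpe n _ hm).trans ?_
    calc ∫⁻ ω, ‖u ⬝ᵥ S.x n ω - u ⬝ᵥ f n (fun k => S.y k ω)‖ₑ ^ 2 ∂P
        ≤ ∫⁻ ω, ENNReal.ofReal (∑ i, ‖u i‖ ^ 2)
          * (∑ i, ‖S.x n ω i - f n (fun k => S.y k ω) i‖ₑ ^ 2) ∂P := by
          refine lintegral_mono fun ω => ?_
          rw [← dotProduct_sub]
          exact enorm_sq_dotProduct_le _ _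
      _ = ENNReal.ofReal (∑ i, ‖u i‖ ^ 2)
          * ∫⁻ ω, (∑ i, ‖S.x n ω i - f n (fun k => S.y k ω) i‖ₑ ^ 2) ∂P :=
          lintegral_const_mul' _ _ ENNReal.ofReal_ne_top
      _ ≤ _ := by
          gcongr
          exact le_iSup (fun n => ∫⁻ ω, (∑ i, ‖S.x n ω i - f n (fun k => S.y k ω) i‖ₑ ^ 2) ∂P) n
  have htop : ENNReal.ofReal (∑ i, ‖u i‖ ^ 2) * K ≠ ⊤ :=
    ENNReal.mul_ne_top ENNReal.ofReal_ne_top hsup.ne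
  have hd : 0 < pe * (σ' ^ 2 * ∑ i, ‖Matrix.vecMul u B i‖ ^ 2) := by positivity
  obtain ⟨n, hn⟩ := exists_nat_gt ((ENNReal.ofReal (∑ i, ‖u i‖ ^ 2) * K).toReal
    / (pe * (σ' ^ 2 * ∑ i, ‖Matrix.vecMul u B i‖ ^ 2)))
  rw [div_lt_iff₀ hd] at hn
  exact absurd ((ENNReal.ofReal_le_iff_le_toReal htop).1 (hbound n)) (not_le.2 hn)

end IntermittentSystem

/-! ### The block estimator. -/

section Decoder

variable {m l : ℕ}

open Classical in
/-- The times `k < N` at which the sequence `y` does not vanish. -/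
noncomputable def nonzeroTimes {M : Type*} [Zero M] (N : ℕ) (y : ℕ → M) : Finset ℕ :=
  (Finset.range N).filter fun k => y k ≠ 0

theorem mem_nonzeroTimes {M : Type*} [Zero M] {N : ℕ} {y : ℕ → M} {k : ℕ} :
    k ∈ nonzeroTimes N y ↔ k < N ∧ y k ≠ 0 := by
  classical simp [nonzeroTimes]

theorem nonzeroTimes_subset {M : Type*} [Zero M] (N : ℕ) (y : ℕ → M) :
    nonzeroTimes N y ⊆ Finset.range N :=
  fun _ hk => Finset.mem_range.2 (mem_nonzeroTimes.1 hk).1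

theorem measurableSet_nonzeroTimes_eq {α M : Type*} [MeasurableSpace α] [Zero M]
    [MeasurableSpace M] [MeasurableSingletonClass M] {N : ℕ} {y : ℕ → α → M}
    (hy : ∀ k < N, Measurable (y k)) (R : Finset ℕ) :
    MeasurableSet {a | nonzeroTimes N (fun k => y k a) = R} := by
  simp only [Finset.ext_iff, mem_nonzeroTimes, Set.ofPred_forall]
  refine MeasurableSet.iInter fun k => ?_
  by_cases hk : k < N
  · have h : MeasurableSet {a | y k a = 0} := (hy k hk) (measurableSet_singleton 0)
    by_cases hR : k ∈ R
    · simp only [hk, hR, true_and, iff_true]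
      exact h.compl
    · simpa [hk, hR] using h
  · simp [hk]

open Classical in
/-- Linear maps which recover the state at time `N` from the observations at the times in `R`,
if these determine it. -/
noncomputable def decoder (A : Matrix (Fin m) (Fin m) ℂ) (C : Matrix (Fin l) (Fin m) ℂ) (N : ℕ)
    (R : Finset ℕ) : ℕ → (Fin l → ℂ) →L[ℂ] (Fin m → ℂ) :=
  if h : Determines A C N R then h.choose else 0

theorem Determines.pow_mulVec_eq {A : Matrix (Fin m) (Fin m) ℂ} {C : Matrix (Fin l) (Fin m) ℂ}
    {N : ℕ} {R : Finset ℕ} (h : Determines A C N R) (x : Fin m → ℂ) :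
    (A ^ N).mulVec x = ∑ k ∈ R, decoder A C N R k (C.mulVec ((A ^ k).mulVec x)) := by
  rw [decoder, dif_pos h]
  exact h.choose_spec x

open Classical in
/-- The estimate of the state at time `j * N` from the observations before that time: it is
renewed at the end of each block of length `N` in which enough is received, and propagated by
`A ^ N` over the other blocks. -/
noncomputable def blockEstimate (A : Matrix (Fin m) (Fin m) ℂ) (C : Matrix (Fin l) (Fin m) ℂ)
    (N : ℕ) : ℕ → (ℕ → Fin l → ℂ) → Fin m → ℂ
  | 0, _ => 0
  | j + 1, y =>
    if Determines A C N (nonzeroTimes N fun k => y (j * N + k)) then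
      ∑ k ∈ nonzeroTimes N fun k => y (j * N + k),
        decoder A C N (nonzeroTimes N fun k => y (j * N + k)) k (y (j * N + k))
    else (A ^ N).mulVec (blockEstimate A C N j y)

variable (A : Matrix (Fin m) (Fin m) ℂ) (C : Matrix (Fin l) (Fin m) ℂ) (N : ℕ)

theorem measurable_mulVec {k k' : ℕ} (M : Matrix (Fin k) (Fin k') ℂ) :
    Measurable fun v : Fin k' → ℂ => M.mulVec v :=
  (Continuous.matrix_mulVec continuous_const continuous_id).measurable

theorem measurable_blockEstimate (j : ℕ) : Measurable (blockEstimate A C N j) := by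
  classical
  induction j with
  | zero => exact measurable_const
  | succ j ih =>
    -- There are countably many finite sets of times, so measurability can be checked with the
    -- reception set frozen.
    let : MeasurableSpace (Finset ℕ) := ⊤
    let G : (ℕ → Fin l → ℂ) × Finset ℕ → Fin m → ℂ := fun p =>
      if Determines A C N p.2 then ∑ k ∈ p.2, decoder A C N p.2 k (p.1 (j * N + k))
      else (A ^ N).mulVec (blockEstimate A C N j p.1)
    have hG : Measurable G := by
      refine measurable_from_prod_countable_left fun R => ?_
      by_cases hR : Determines A C N R
      · simp only [G, hR, if_true]
        exact Finset.measurable_fun_sum _ fun k _ =>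
          (decoder A C N R k).measurable.comp (measurable_pi_apply _)
      · simp only [G, hR, if_false]
        exact (measurable_mulVec _).comp ih
    have hR : Measurable fun y : ℕ → Fin l → ℂ => nonzeroTimes N fun k => y (j * N + k) :=
      measurable_to_countable' fun R =>
        measurableSet_nonzeroTimes_eq (fun k _ => measurable_pi_apply (j * N + k)) R
    exact hG.comp (measurable_id.prodMk hR)

/-- Causality of the estimator; it also makes the error at the start of a block independent of the
later erasures. -/
theorem blockEstimate_congr (j : ℕ) {y y' : ℕ → Fin l → ℂ} (h : ∀ i < j * N, y i = y' i) :
    blockEstimate A C N j y = blockEstimate A C N j y' := by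
  classical
  induction j with
  | zero => rfl
  | succ j ih =>
    have h1 : ∀ k < N, y (j * N + k) = y' (j * N + k) :=
      fun k hk => h _ (by rw [Nat.succ_mul]; omega)
    have hR : nonzeroTimes N (fun k => y (j * N + k)) = nonzeroTimes N fun k => y' (j * N + k) := by
      ext k
      simp only [mem_nonzeroTimes]
      exact and_congr_right fun hk => by rw [h1 k hk]
    have hsum : ∀ D : ℕ → (Fin l → ℂ) →L[ℂ] (Fin m → ℂ),
        ∑ k ∈ nonzeroTimes N (fun k => y' (j * N + k)), D k (y (j * N + k))
          = ∑ k ∈ nonzeroTimes N (fun k => y' (j * N + k)), D k (y' (j * N + k)) :=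
      fun D => Finset.sum_congr rfl fun k hk => by rw [h1 k (mem_nonzeroTimes.1 hk).1]
    simp only [blockEstimate, hR, hsum, ih fun i hi => h i (by rw [Nat.succ_mul]; omega)]

end Decoder

theorem sum_enorm_sq_le {m : ℕ} (e : Fin m → ℂ) : ∑ i, ‖e i‖ₑ ^ 2 ≤ m * ‖e‖ₑ ^ 2 := by
  have h : ∀ i ∈ Finset.univ, ‖e i‖ₑ ^ 2 ≤ ‖e‖ₑ ^ 2 := by
    intro i _
    rw [← ofReal_norm, ← ofReal_norm]
    gcongr
    exact norm_le_pi_norm e i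
  simpa using Finset.sum_le_card_nsmul _ _ _ h

/-! ### Drift within a block and the law of the reception pattern. -/

namespace IntermittentSystem

variable {m g l : ℕ} {A : Matrix (Fin m) (Fin m) ℂ} {B : Matrix (Fin m) (Fin g) ℂ}
  {C : Matrix (Fin l) (Fin m) ℂ} {σ σ' pe : ℝ} {Ω : Type*} [MeasurableSpace Ω] {P : Measure Ω}
  (S : IntermittentSystem A B C σ σ' pe P)

section
open scoped Matrix.Norms.Operator

/-- Over at most `N` steps, the state departs from its free evolution by no more than a constant
times the size of the disturbances. -/
theorem exists_norm_sub_pow_mulVec_le (N : ℕ) :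
    ∃ K : ℝ, 0 ≤ K ∧ ∀ t k ω, k ≤ N → ‖S.x (t + k) ω - (A ^ k).mulVec (S.x t ω)‖
      ≤ K * ∑ i ∈ Finset.range N, ‖S.w (t + i) ω‖ := by
  have key : ∀ t k ω, ‖S.x (t + k) ω - (A ^ k).mulVec (S.x t ω)‖
      ≤ (‖A‖ + 1) ^ k * ‖B‖ * ∑ i ∈ Finset.range k, ‖S.w (t + i) ω‖ := by
    intro t k ω
    induction k with
    | zero => simp
    | succ k ih =>
      have h1 : S.x (t + (k + 1)) ω - (A ^ (k + 1)).mulVec (S.x t ω)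
          = A.mulVec (S.x (t + k) ω - (A ^ k).mulVec (S.x t ω)) + B.mulVec (S.w (t + k) ω) := by
        rw [← add_assoc, S.state_eq, Matrix.mulVec_sub, Matrix.mulVec_mulVec, ← pow_succ']
        abel
      rw [h1, Finset.sum_range_succ, mul_add]
      refine (norm_add_le _ _).trans (add_le_add ?_ ?_)
      · refine (Matrix.linfty_opNorm_mulVec _ _).trans ?_
        calc ‖A‖ * ‖S.x (t + k) ω - (A ^ k).mulVec (S.x t ω)‖
            ≤ (‖A‖ + 1) * ((‖A‖ + 1) ^ k * ‖B‖ * ∑ i ∈ Finset.range k, ‖S.w (t + i) ω‖) := by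
              gcongr
              linarith
          _ = _ := by ring
      · refine (Matrix.linfty_opNorm_mulVec _ _).trans ?_
        gcongr
        exact le_mul_of_one_le_left (norm_nonneg _)
          (one_le_pow₀ (le_add_of_nonneg_left (norm_nonneg _)))
  refine ⟨(‖A‖ + 1) ^ N * ‖B‖, by positivity, fun t k ω hk => (key t k ω).trans ?_⟩
  gcongr
  exact le_add_of_nonneg_left (norm_nonneg _)

end

/-- The received times in the block of length `N` that starts at time `t`. -/
noncomputable def received (t N : ℕ) (ω : Ω) : Finset ℕ := nonzeroTimes N fun k => S.β (t + k) ω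

theorem measurableSet_info_received {T : Set (Unit ⊕ ℕ ⊕ ℕ ⊕ ℕ)} {t N : ℕ}
    (hT : ∀ k < N, .inr (.inr (.inr (t + k))) ∈ T) (p : Finset ℕ → Prop) :
    MeasurableSet[S.info T] {ω | p (S.received t N ω)} := by
  have h : {ω | p (S.received t N ω)}
      = ⋃ R : Finset ℕ, ⋃ _ : p R, {ω | nonzeroTimes N (fun k => S.β (t + k) ω) = R} := by
    ext ω
    simp [received]
  rw [h]
  refine MeasurableSet.iUnion fun R => MeasurableSet.iUnion fun _ => ?_
  exact @measurableSet_nonzeroTimes_eq Ω ℝ (S.info T) _ _ _ N (fun k => S.β (t + k))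
    (fun k hk => S.measurable_info_β (hT k hk)) R

theorem measure_received_eq [IsProbabilityMeasure P] {t N : ℕ} {R : Finset ℕ}
    (hR : R ⊆ Finset.range N) :
    P {ω | S.received t N ω = R} = ENNReal.ofReal ((1 - pe) ^ R.card * pe ^ (N - R.card)) := by
  classical
  have hpe0 := S.erasure_nonneg
  have hpe1 := S.erasure_le_one
  let s : ℕ → Set Ω := fun k =>
    if k ∈ R then {ω | S.β (t + k) ω = 0}ᶜ else {ω | S.β (t + k) ω = 0}
  have hset : {ω | S.received t N ω = R} = ⋂ k ∈ Finset.range N, s k := by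
    ext ω
    simp only [Set.mem_ofPred_eq, received, Finset.ext_iff, mem_nonzeroTimes, Set.mem_iInter,
      Finset.mem_range, s]
    constructor
    · intro h k hk
      by_cases hkR : k ∈ R
      · simpa [hkR] using ((h k).2 hkR).2
      · simpa [hkR, hk] using h k
    · intro h k
      constructor
      · rintro ⟨hk, hne⟩
        by_contra hkR
        have := h k hk
        rw [if_neg hkR] at this
        exact hne this
      · intro hkR
        have hk := Finset.mem_range.1 (hR hkR)
        have := h k hk
        rw [if_pos hkR] at this
        exact ⟨hk, this⟩
  have hinj : Function.Injective fun k : ℕ => (.inr (.inr (.inr (t + k))) : Unit ⊕ ℕ ⊕ ℕ ⊕ ℕ) :=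
    fun a b hab => by simpa using hab
  have hind := S.indep.precomp hinj
  have hms : ∀ k, MeasurableSet[MeasurableSpace.comap (S.β (t + k)) inferInstance]
      {ω | S.β (t + k) ω = 0} := fun k => ⟨{0}, measurableSet_singleton 0, rfl⟩
  have hprod := hind.meas_biInter (S := Finset.range N) (s := s) (fun k _ => by
    by_cases hkR : k ∈ R
    · simp only [s, if_pos hkR]
      exact (hms k).compl
    · simp only [s, if_neg hkR]
      exact hms k)
  have hP : ∀ k, P (s k) = if k ∈ R then ENNReal.ofReal (1 - pe) else ENNReal.ofReal pe := by
    intro k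
    by_cases hkR : k ∈ R
    · simp only [s, if_pos hkR]
      have h0 : MeasurableSet {ω | S.β (t + k) ω = 0} :=
        S.measurable_β (t + k) (measurableSet_singleton 0)
      rw [prob_compl_eq_one_sub h0,
        S.measure_erased, ENNReal.ofReal_sub _ hpe0, ENNReal.ofReal_one]
    · simp only [s, if_neg hkR]
      exact S.measure_erased (t + k)
  rw [hset, hprod]
  simp_rw [hP]
  rw [Finset.prod_ite, Finset.prod_const, Finset.prod_const, Finset.filter_mem_eq_inter,
    Finset.inter_eq_right.2 hR, Finset.filter_notMem_eq_sdiff, Finset.card_sdiff_of_subset hR,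
    Finset.card_range, ENNReal.ofReal_mul (by have := sub_nonneg.2 hpe1; positivity),
    ENNReal.ofReal_pow (sub_nonneg.2 hpe1), ENNReal.ofReal_pow hpe0]

theorem measure_not_determines_le [IsProbabilityMeasure P] (t N : ℕ) :
    P {ω | ¬ Determines A C N (S.received t N ω)}
      ≤ ENNReal.ofReal (undeterminedProb A C pe N) := by
  classical
  have hpe0 := S.erasure_nonneg
  have hpe1 := sub_nonneg.2 S.erasure_le_one
  have hsub : {ω | ¬ Determines A C N (S.received t N ω)}
      ⊆ ⋃ R ∈ (Finset.range N).powerset.filter fun R => ¬ Determines A C N R,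
        {ω | S.received t N ω = R} := by
    intro ω hω
    simp only [Set.mem_iUnion]
    exact ⟨S.received t N ω, Finset.mem_filter.2 ⟨Finset.mem_powerset.2 (nonzeroTimes_subset _ _),
      hω⟩, rfl⟩
  refine (measure_mono hsub).trans ((measure_biUnion_finset_le _ _).trans (le_of_eq ?_))
  rw [undeterminedProb, ENNReal.ofReal_sum_of_nonneg fun R _ => by positivity]
  refine Finset.sum_congr (by congr) fun R hR => ?_
  exact S.measure_received_eq (Finset.mem_powerset.1 (Finset.mem_filter.1 hR).1)

theorem ae_eq_zero_or_one [IsProbabilityMeasure P] :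
    ∀ᵐ ω ∂P, ∀ n, S.β n ω = 0 ∨ S.β n ω = 1 := by
  refine ae_all_iff.2 fun n => ?_
  have h0 : MeasurableSet {ω | S.β n ω = 0} := S.measurable_β n (measurableSet_singleton 0)
  have h1 : MeasurableSet {ω | S.β n ω = 1} := S.measurable_β n (measurableSet_singleton 1)
  have hdisj : Disjoint {ω | S.β n ω = 0} {ω | S.β n ω = 1} := by
    rw [Set.disjoint_left]
    intro ω ha hb
    simp only [Set.mem_ofPred_eq] at ha hb
    linarith
  have h2 : P.real ({ω | S.β n ω = 0} ∪ {ω | S.β n ω = 1}) = 1 := by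
    rw [measureReal_union hdisj h1, S.prob_erased, S.prob_received]
    ring
  have h3 : P ({ω | S.β n ω = 0} ∪ {ω | S.β n ω = 1}) = 1 := by
    rw [← ofReal_measureReal (measure_ne_top P _), h2, ENNReal.ofReal_one]
  exact (mem_ae_iff_prob_eq_one (h0.union h1)).2 h3

/-- The estimator does not see `β`. The nondegenerate noise `v[n]`, independent of `x[n]`, makes
every received packet nonzero almost surely, so the nonzero observations reveal the reception times.
-/
theorem ae_ne_zero [IsProbabilityMeasure P] (hσ' : 0 < σ') (hl : 0 < l) :
    ∀ᵐ ω ∂P, ∀ n, C.mulVec (S.x n ω) + S.v n ω ≠ 0 := by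
  refine ae_all_iff.2 fun n => ?_
  have hind : IndepFun (fun ω => C.mulVec (S.x n ω)) (S.v n) P := by
    refine S.indepFun_of_measurable_info (T := {.inr (.inr (.inl n))}ᶜ)
      (T' := {.inr (.inr (.inl n))}) disjoint_compl_left
      ((measurable_mulVec C).comp (S.measurable_info_x ?_ ?_))
      (S.measurable_info_v (Set.mem_singleton _)) <;> simp
  have h := measure_add_eq_zero_of_posSemidef hσ' hl ((measurable_mulVec C).comp (S.measurable_x n))
    (S.measurable_v n) (S.gaussian_v n) hind (S.mean_v n) (S.lower_v n)
  rw [ae_iff]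
  simpa using h

end IntermittentSystem

/-! ### Contraction of the block error and sufficiency of the threshold. -/

theorem enorm_sq_le_of_norm_le {E ι F G : Type*} [NormedAddCommGroup E] [NormedAddCommGroup F]
    [NormedAddCommGroup G] {s : Finset ι} {e e' : E} {w : ι → F} {v : ι → G} {a b : ℝ}
    (h : ‖e'‖ ≤ a * ‖e‖ + b * ∑ i ∈ s, (‖w i‖ + ‖v i‖)) :
    ‖e'‖ₑ ^ 2 ≤ ENNReal.ofReal (2 * a ^ 2) * ‖e‖ₑ ^ 2
      + ENNReal.ofReal (4 * b ^ 2 * s.card) * ∑ i ∈ s, (‖w i‖ₑ ^ 2 + ‖v i‖ₑ ^ 2) := by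
  have h1 : ‖e'‖ ^ 2 ≤ 2 * a ^ 2 * ‖e‖ ^ 2
      + 4 * b ^ 2 * s.card * ∑ i ∈ s, (‖w i‖ ^ 2 + ‖v i‖ ^ 2) := by
    have h2 : (∑ i ∈ s, (‖w i‖ + ‖v i‖)) ^ 2 ≤ s.card * (2 * ∑ i ∈ s, (‖w i‖ ^ 2 + ‖v i‖ ^ 2)) := by
      refine sq_sum_le_card_mul_sum_sq.trans ?_
      refine mul_le_mul_of_nonneg_left ?_ (Nat.cast_nonneg _)
      rw [Finset.mul_sum]
      exact Finset.sum_le_sum fun i _ => add_sq_le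
    calc ‖e'‖ ^ 2 ≤ (a * ‖e‖ + b * ∑ i ∈ s, (‖w i‖ + ‖v i‖)) ^ 2 := by gcongr
      _ ≤ 2 * ((a * ‖e‖) ^ 2 + (b * ∑ i ∈ s, (‖w i‖ + ‖v i‖)) ^ 2) := add_sq_le
      _ = 2 * a ^ 2 * ‖e‖ ^ 2 + 2 * b ^ 2 * (∑ i ∈ s, (‖w i‖ + ‖v i‖)) ^ 2 := by ring
      _ ≤ 2 * a ^ 2 * ‖e‖ ^ 2
          + 2 * b ^ 2 * (s.card * (2 * ∑ i ∈ s, (‖w i‖ ^ 2 + ‖v i‖ ^ 2))) := by gcongr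
      _ = _ := by ring
  have h3 := ENNReal.ofReal_le_ofReal h1
  rw [ENNReal.ofReal_add (by positivity) (by positivity), ENNReal.ofReal_mul (by positivity),
    ENNReal.ofReal_mul (p := 4 * b ^ 2 * s.card) (by positivity),
    ENNReal.ofReal_sum_of_nonneg fun i _ => by positivity] at h3
  simpa [ENNReal.ofReal_add, ENNReal.ofReal_pow, ofReal_norm] using h3

namespace IntermittentSystem

variable {m g l : ℕ} {A : Matrix (Fin m) (Fin m) ℂ} {B : Matrix (Fin m) (Fin g) ℂ}
  {C : Matrix (Fin l) (Fin m) ℂ} {σ σ' pe : ℝ} {Ω : Type*} [MeasurableSpace Ω] {P : Measure Ω}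
  (S : IntermittentSystem A B C σ σ' pe P)

/-- The error of the block estimate of the state at time `j * N`. -/
noncomputable def blockError (N j : ℕ) (ω : Ω) : Fin m → ℂ :=
  S.x (j * N) ω - blockEstimate A C N j fun n => S.y n ω

theorem measurable_info_blockError {T : Set (Unit ⊕ ℕ ⊕ ℕ ⊕ ℕ)} {N j : ℕ} (h0 : .inl () ∈ T)
    (hw : ∀ i, .inr (.inl i) ∈ T) (hv : ∀ i, .inr (.inr (.inl i)) ∈ T)
    (hβ : ∀ i < j * N, .inr (.inr (.inr i)) ∈ T) : Measurable[S.info T] (S.blockError N j) := by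
  have hx : Measurable[S.info T] (S.x (j * N)) := S.measurable_info_x h0 fun i _ => hw i
  have hy : Measurable[S.info T] fun ω n => if n < j * N then S.y n ω else 0 := by
    refine @measurable_pi_lambda _ _ _ (S.info T) _ _ fun n => ?_
    by_cases hn : n < j * N
    · simp only [hn, if_true]
      exact S.measurable_info_y h0 (fun i _ => hw i) (hv n) (hβ n hn)
    · simp only [hn, if_false]
      exact @measurable_const _ _ _ (S.info T) _
  have he : S.blockError N j = fun ω =>
      S.x (j * N) ω - blockEstimate A C N j fun n => if n < j * N then S.y n ω else 0 := by
    funext ω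
    rw [blockError, blockEstimate_congr A C N j]
    intro i hi
    rw [if_pos hi]
  rw [he]
  exact hx.sub ((measurable_blockEstimate A C N j).comp hy)

theorem measurable_blockError (N j : ℕ) : Measurable (S.blockError N j) :=
  (S.measurable_info_blockError (T := Set.univ) trivial (fun _ => trivial) (fun _ => trivial)
    fun _ _ => trivial).mono (S.info_le _) le_rfl

open Classical in
open scoped Matrix.Norms.Operator in
/-- The block error contracts to the size of the noise in the blocks that determine the state,
and is multiplied by `A ^ N` in the others. -/
theorem exists_norm_blockError_succ_le {N : ℕ} {α : ℝ}
    (hα : ∀ v : Fin m → ℂ, ‖(A ^ N).mulVec v‖ ≤ α * ‖v‖) :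
    ∃ K : ℝ, 0 ≤ K ∧ ∀ j ω, (∀ n, S.β n ω = 0 ∨ S.β n ω = 1) →
      (∀ n, C.mulVec (S.x n ω) + S.v n ω ≠ 0) →
      ‖S.blockError N (j + 1) ω‖
        ≤ α * ‖{ω | ¬ Determines A C N (S.received (j * N) N ω)}.indicator (S.blockError N j) ω‖
          + K * ∑ i ∈ Finset.range N, (‖S.w (j * N + i) ω‖ + ‖S.v (j * N + i) ω‖) := by
  obtain ⟨K, hK0, hK⟩ := S.exists_norm_sub_pow_mulVec_le N
  set M : ℝ := ∑ R ∈ (Finset.range N).powerset, ∑ k ∈ Finset.range N, ‖decoder A C N R k‖ with hM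
  have hM0 : 0 ≤ M := by positivity
  -- `K` is the drift of the state over the block, `M` bounds all decoders at once, and `‖C‖ * K +
  -- 1` bounds the deviation of an observation from its noiseless value by drift plus noise.
  refine ⟨K + M * (‖C‖ * K + 1), by positivity, fun j ω hβ hne => ?_⟩
  set t := j * N with ht
  set W := ∑ i ∈ Finset.range N, (‖S.w (t + i) ω‖ + ‖S.v (t + i) ω‖) with hW
  have hW0 : 0 ≤ W := by positivity
  have hwW : ∑ i ∈ Finset.range N, ‖S.w (t + i) ω‖ ≤ W :=
    Finset.sum_le_sum fun i _ => le_add_of_nonneg_right (norm_nonneg _)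
  have hvW : ∀ k < N, ‖S.v (t + k) ω‖ ≤ W := fun k hk =>
    (le_add_of_nonneg_left (norm_nonneg _)).trans
      (Finset.single_le_sum (f := fun i => ‖S.w (t + i) ω‖ + ‖S.v (t + i) ω‖)
        (fun i _ => by positivity) (Finset.mem_range.2 hk))
  have hdrift : ∀ k ≤ N, ‖S.x (t + k) ω - (A ^ k).mulVec (S.x t ω)‖ ≤ K * W := fun k hk =>
    (hK t k ω hk).trans (by gcongr)
  set R := S.received t N ω with hR
  have hRy : nonzeroTimes N (fun k => S.y (t + k) ω) = R := by
    ext k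
    rw [hR, received, mem_nonzeroTimes, mem_nonzeroTimes, S.obs_eq, smul_ne_zero_iff]
    simp [hne]
  have hyR : ∀ k ∈ R, S.y (t + k) ω = C.mulVec (S.x (t + k) ω) + S.v (t + k) ω := by
    intro k hk
    have h1 := (hβ (t + k)).resolve_left (mem_nonzeroTimes.1 hk).2
    rw [S.obs_eq, h1, Complex.ofReal_one, one_smul]
  have hRN : ∀ k ∈ R, k < N := fun k hk => (mem_nonzeroTimes.1 hk).1
  have hrec : S.blockError N (j + 1) ω = S.x (t + N) ω - if Determines A C N R then
      ∑ k ∈ R, decoder A C N R k (S.y (t + k) ω) else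
        (A ^ N).mulVec (blockEstimate A C N j fun n => S.y n ω) := by
    rw [blockError, blockEstimate, Nat.succ_mul]
    simp only [← ht, hRy]
  rw [hrec]
  by_cases hdet : Determines A C N R
  · rw [if_pos hdet]
    have hmem : ω ∉ {ω | ¬ Determines A C N (S.received t N ω)} := fun h => h hdet
    have hind := Set.indicator_of_notMem hmem (S.blockError N j)
    rw [hind, norm_zero, mul_zero, zero_add]
    have hsplit : S.x (t + N) ω - ∑ k ∈ R, decoder A C N R k (S.y (t + k) ω)
        = (S.x (t + N) ω - (A ^ N).mulVec (S.x t ω))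
          - ∑ k ∈ R, decoder A C N R k
            (C.mulVec (S.x (t + k) ω - (A ^ k).mulVec (S.x t ω)) + S.v (t + k) ω) := by
      rw [hdet.pow_mulVec_eq, sub_sub, ← Finset.sum_add_distrib]
      congr 1
      refine Finset.sum_congr rfl fun k hk => ?_
      rw [hyR k hk, ← map_add, Matrix.mulVec_sub]
      congr 1
      abel
    rw [hsplit, add_mul]
    refine (norm_sub_le _ _).trans (add_le_add (hdrift N le_rfl) ?_)
    calc ‖∑ k ∈ R, decoder A C N R k
            (C.mulVec (S.x (t + k) ω - (A ^ k).mulVec (S.x t ω)) + S.v (t + k) ω)‖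
        ≤ ∑ k ∈ R, ‖decoder A C N R k‖ * ((‖C‖ * K + 1) * W) := by
          refine (norm_sum_le _ _).trans (Finset.sum_le_sum fun k hk => ?_)
          refine (ContinuousLinearMap.le_opNorm _ _).trans ?_
          gcongr
          rw [add_mul, one_mul, mul_assoc]
          refine (norm_add_le _ _).trans (add_le_add ?_ (hvW k (hRN k hk)))
          refine (Matrix.linfty_opNorm_mulVec _ _).trans ?_
          gcongr
          exact hdrift k (hRN k hk).le
      _ = (∑ k ∈ R, ‖decoder A C N R k‖) * ((‖C‖ * K + 1) * W) := by rw [Finset.sum_mul]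
      _ ≤ M * ((‖C‖ * K + 1) * W) := by
          gcongr
          have hsub : R ⊆ Finset.range N := nonzeroTimes_subset _ _
          refine (Finset.sum_le_sum_of_subset_of_nonneg hsub fun _ _ _ => norm_nonneg _).trans ?_
          exact Finset.single_le_sum
            (f := fun R => ∑ k ∈ Finset.range N, ‖decoder A C N R k‖)
            (fun _ _ => by positivity) (Finset.mem_powerset.2 hsub)
      _ = M * (‖C‖ * K + 1) * W := by ring
  · rw [if_neg hdet]
    have hmem : ω ∈ {ω | ¬ Determines A C N (S.received t N ω)} := hdet
    have hind := Set.indicator_of_mem hmem (S.blockError N j)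
    have hsplit : S.x (t + N) ω - (A ^ N).mulVec (blockEstimate A C N j fun n => S.y n ω)
        = (A ^ N).mulVec (S.blockError N j ω)
          + (S.x (t + N) ω - (A ^ N).mulVec (S.x t ω)) := by
      rw [blockError, Matrix.mulVec_sub]
      abel
    rw [hind, hsplit]
    refine (norm_add_le _ _).trans (add_le_add (hα _) ((hdrift N le_rfl).trans ?_))
    gcongr
    exact le_add_of_nonneg_right (by positivity)

theorem lintegral_noise_le [IsProbabilityMeasure P] (t N : ℕ) :
    ∫⁻ ω, ∑ i ∈ Finset.range N, (‖S.w (t + i) ω‖ₑ ^ 2 + ‖S.v (t + i) ω‖ₑ ^ 2) ∂P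
      ≤ N * (g * ENNReal.ofReal (σ ^ 2) + l * ENNReal.ofReal (σ ^ 2)) := by
  have hw : ∀ n, Measurable fun ω => ‖S.w n ω‖ₑ ^ 2 := fun n => (S.measurable_w n).enorm.pow_const 2
  have hv : ∀ n, Measurable fun ω => ‖S.v n ω‖ₑ ^ 2 := fun n => (S.measurable_v n).enorm.pow_const 2
  have hwv : ∀ n, Measurable fun ω => ‖S.w n ω‖ₑ ^ 2 + ‖S.v n ω‖ₑ ^ 2 :=
    fun n => (hw n).add (hv n)
  rw [lintegral_finsetSum _ fun i _ => hwv (t + i)]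
  have h : ∀ i ∈ Finset.range N, ∫⁻ ω, (‖S.w (t + i) ω‖ₑ ^ 2 + ‖S.v (t + i) ω‖ₑ ^ 2) ∂P
      ≤ g * ENNReal.ofReal (σ ^ 2) + l * ENNReal.ofReal (σ ^ 2) := by
    intro i _
    rw [lintegral_add_left (hw _)]
    exact add_le_add (lintegral_enorm_sq_le (S.gaussian_w _) (S.upper_w _))
      (lintegral_enorm_sq_le (S.gaussian_v _) (S.upper_v _))
  simpa [mul_add] using Finset.sum_le_card_nsmul _ _ _ h

/-- The mean square block error is bounded, if the undetermined blocks are improbable enough. -/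
theorem exists_lintegral_blockError_le [IsProbabilityMeasure P] (hσ' : 0 < σ') (hl : 0 < l)
    {N : ℕ} {α : ℝ} (hα : ∀ v : Fin m → ℂ, ‖(A ^ N).mulVec v‖ ≤ α * ‖v‖)
    (hprob : 2 * α ^ 2 * undeterminedProb A C pe N ≤ 1 / 2) :
    ∃ M : ENNReal, M < ⊤ ∧ ∀ j, ∫⁻ ω, ‖S.blockError N j ω‖ₑ ^ 2 ∂P ≤ M := by
  obtain ⟨K, hK0, hK⟩ := S.exists_norm_blockError_succ_le hα
  set D : ENNReal := ENNReal.ofReal (4 * K ^ 2 * N)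
    * (N * (g * ENNReal.ofReal (σ ^ 2) + l * ENNReal.ofReal (σ ^ 2))) with hD
  have hDtop : D < ⊤ := by
    rw [hD]
    finiteness
  have hstep : ∀ j, ∫⁻ ω, ‖S.blockError N (j + 1) ω‖ₑ ^ 2 ∂P
      ≤ ENNReal.ofReal (1 / 2) * ∫⁻ ω, ‖S.blockError N j ω‖ₑ ^ 2 ∂P + D := by
    intro j
    set E : Set Ω := {ω | ¬ Determines A C N (S.received (j * N) N ω)} with hE
    -- `E` depends only on `β` from time `j * N` on, and the block error only on the other inputs;
    -- this independence turns the indicator into the factor `P E`.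
    have hEm : MeasurableSet[S.info {i | ∃ n ≥ j * N, i = .inr (.inr (.inr n))}] E :=
      S.measurableSet_info_received (T := {i | ∃ n ≥ j * N, i = .inr (.inr (.inr n))})
        (fun k _ => ⟨j * N + k, Nat.le_add_right _ _, rfl⟩)
        fun R => ¬ Determines A C N R
    have hem : Measurable[S.info {i | ∃ n ≥ j * N, i = .inr (.inr (.inr n))}ᶜ]
        (S.blockError N j) := by
      refine S.measurable_info_blockError ?_ ?_ ?_ ?_ <;> simp
    have hmeas : Measurable fun ω => E.indicator 1 ω * ‖S.blockError N j ω‖ₑ ^ 2 :=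
      (measurable_one.indicator (S.info_le _ _ hEm)).mul
        ((S.measurable_blockError N j).enorm.pow_const 2)
    have hind : ∫⁻ ω, E.indicator 1 ω * ‖S.blockError N j ω‖ₑ ^ 2 ∂P
        = P E * ∫⁻ ω, ‖S.blockError N j ω‖ₑ ^ 2 ∂P :=
      S.lintegral_indicator_one_mul_of_info disjoint_compl_right hEm
        ((measurable_enorm.pow_const 2).comp hem)
    have hpt : ∀ᵐ ω ∂P, ‖S.blockError N (j + 1) ω‖ₑ ^ 2
        ≤ ENNReal.ofReal (2 * α ^ 2) * (E.indicator 1 ω * ‖S.blockError N j ω‖ₑ ^ 2)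
          + ENNReal.ofReal (4 * K ^ 2 * N) * ∑ i ∈ Finset.range N,
            (‖S.w (j * N + i) ω‖ₑ ^ 2 + ‖S.v (j * N + i) ω‖ₑ ^ 2) := by
      filter_upwards [S.ae_eq_zero_or_one, S.ae_ne_zero hσ' hl] with ω h1 h2
      have h3 := enorm_sq_le_of_norm_le (hK j ω h1 h2)
      rw [Finset.card_range] at h3
      refine h3.trans_eq ?_
      by_cases hω : ω ∈ E <;> simp [hω, ← hE]
    calc ∫⁻ ω, ‖S.blockError N (j + 1) ω‖ₑ ^ 2 ∂P
        ≤ ENNReal.ofReal (2 * α ^ 2) * (P E * ∫⁻ ω, ‖S.blockError N j ω‖ₑ ^ 2 ∂P)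
          + ENNReal.ofReal (4 * K ^ 2 * N) * ∫⁻ ω, ∑ i ∈ Finset.range N,
            (‖S.w (j * N + i) ω‖ₑ ^ 2 + ‖S.v (j * N + i) ω‖ₑ ^ 2) ∂P := by
          refine (lintegral_mono_ae hpt).trans_eq ?_
          rw [lintegral_add_left (hmeas.const_mul _), lintegral_const_mul _ hmeas, hind,
            lintegral_const_mul' _ _ ENNReal.ofReal_ne_top]
      _ ≤ ENNReal.ofReal (1 / 2) * ∫⁻ ω, ‖S.blockError N j ω‖ₑ ^ 2 ∂P + D := by
          rw [← mul_assoc]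
          refine add_le_add ?_ (mul_le_mul_right (S.lintegral_noise_le _ _) _)
          gcongr
          calc ENNReal.ofReal (2 * α ^ 2) * P E
              ≤ ENNReal.ofReal (2 * α ^ 2) * ENNReal.ofReal (undeterminedProb A C pe N) := by
                gcongr
                exact S.measure_not_determines_le _ _
            _ = ENNReal.ofReal (2 * α ^ 2 * undeterminedProb A C pe N) :=
                (ENNReal.ofReal_mul (by positivity)).symm
            _ ≤ ENNReal.ofReal (1 / 2) := ENNReal.ofReal_le_ofReal hprob
  -- `2 * D` is the fixed point of `e ↦ e / 2 + D`, and the first term covers the initial error.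
  refine ⟨m * ENNReal.ofReal (σ ^ 2) + 2 * D, by finiteness, fun j => ?_⟩
  induction j with
  | zero =>
    have h0 : ∀ ω, S.blockError N 0 ω = S.x 0 ω := by
      intro ω
      rw [blockError, blockEstimate, sub_zero, zero_mul]
    simp_rw [h0]
    exact (lintegral_enorm_sq_le S.gaussian_x0 S.upper_x0).trans le_self_add
  | succ j ih =>
    have hhalf : ENNReal.ofReal (1 / 2) = 2⁻¹ := by
      rw [one_div, ENNReal.ofReal_inv_of_pos two_pos, ENNReal.ofReal_ofNat]
    calc ∫⁻ ω, ‖S.blockError N (j + 1) ω‖ₑ ^ 2 ∂P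
        ≤ 2⁻¹ * (m * ENNReal.ofReal (σ ^ 2) + 2 * D) + D := by
          rw [← hhalf]
          exact (hstep j).trans (by gcongr)
      _ = 2⁻¹ * (m * ENNReal.ofReal (σ ^ 2)) + 2 * D := by
          rw [mul_add, ← mul_assoc 2⁻¹ 2 D, ENNReal.inv_mul_cancel two_ne_zero (by simp), one_mul,
            add_assoc, two_mul]
      _ ≤ m * ENNReal.ofReal (σ ^ 2) + 2 * D := by
          exact add_le_add (mul_le_of_le_one_left zero_le (ENNReal.inv_le_one.2 one_le_two)) le_rfl

open scoped Matrix.Norms.Operator in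
theorem isIntermittentObservable_of_lt_one [IsProbabilityMeasure P] (hσ' : 0 < σ') (hl : 0 < l)
    (hAC : IsObservable A C) (hcyc : NoEigenvalueCycles A) {r : ℝ} (hr0 : 0 ≤ r)
    (hr : ∀ μ ∈ spectrum ℂ A, ‖μ‖ ≤ r) (hpe : pe * r ^ 2 < 1) : S.IsIntermittentObservable := by
  obtain ⟨N, hN, α, hα, hprob⟩ := exists_undeterminedProb_mul_le hAC hcyc S.erasure_nonneg
    S.erasure_le_one hr hr0 hpe
  obtain ⟨M, hM, hbound⟩ := S.exists_lintegral_blockError_le hσ' hl hα hprob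
  obtain ⟨K, hK0, hK⟩ := S.exists_norm_sub_pow_mulVec_le N
  set a : ℝ := ∑ k ∈ Finset.range N, ‖A ^ k‖ with ha
  let ext : (n : ℕ) → (Fin (n + 1) → Fin l → ℂ) → ℕ → Fin l → ℂ :=
    fun n z k => if hk : k < n + 1 then z ⟨k, hk⟩ else 0
  have hext : ∀ n, Measurable (ext n) := by
    intro n
    refine measurable_pi_iff.2 fun k => ?_
    change Measurable fun z : Fin (n + 1) → Fin l → ℂ => if hk : k < n + 1 then z ⟨k, hk⟩ else 0
    split_ifs
    · exact measurable_pi_apply _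
    · exact measurable_const
  -- Inside a block the last block estimate is propagated freely; this costs at most a fixed factor
  -- and a bounded drift, as fewer than `N` steps are taken.
  refine ⟨fun n z => (A ^ (n % N)).mulVec (blockEstimate A C N (n / N) (ext n z)), fun n =>
    (measurable_mulVec _).comp ((measurable_blockEstimate A C N _).comp (hext n)), ?_⟩
  set D : ENNReal := N * (g * ENNReal.ofReal (σ ^ 2) + l * ENNReal.ofReal (σ ^ 2)) with hD
  have hfin : (m : ENNReal) * (ENNReal.ofReal (2 * a ^ 2) * M + ENNReal.ofReal (4 * K ^ 2 * N) * D)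
      < ⊤ := by
    rw [hD]
    finiteness
  refine lt_of_le_of_lt (iSup_le fun n => ?_) hfin
  set j := n / N with hj
  set k := n % N with hk
  have hkN : k < N := Nat.mod_lt _ hN
  have hn : n = j * N + k := by rw [mul_comm]; exact (Nat.div_add_mod n N).symm
  have hpt : ∀ ω, ∑ i, ‖S.x n ω i
      - (A ^ k).mulVec (blockEstimate A C N j (ext n fun k => S.y k ω)) i‖ₑ ^ 2
      ≤ m * (ENNReal.ofReal (2 * a ^ 2) * ‖S.blockError N j ω‖ₑ ^ 2
        + ENNReal.ofReal (4 * K ^ 2 * N) * ∑ i ∈ Finset.range N,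
            (‖S.w (j * N + i) ω‖ₑ ^ 2 + ‖S.v (j * N + i) ω‖ₑ ^ 2)) := by
    intro ω
    have hest : blockEstimate A C N j (ext n fun k => S.y k ω)
        = blockEstimate A C N j fun n => S.y n ω := by
      refine blockEstimate_congr A C N j fun i hi => ?_
      exact dif_pos (by omega)
    have hsplit : S.x n ω - (A ^ k).mulVec (blockEstimate A C N j fun n => S.y n ω)
        = (A ^ k).mulVec (S.blockError N j ω)
          + (S.x (j * N + k) ω - (A ^ k).mulVec (S.x (j * N) ω)) := by
      rw [blockError, Matrix.mulVec_sub, ← hn]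
      abel
    refine (sum_enorm_sq_le (S.x n ω
      - (A ^ k).mulVec (blockEstimate A C N j (ext n fun k => S.y k ω)))).trans ?_
    gcongr
    have hnorm := enorm_sq_le_of_norm_le (s := Finset.range N) (a := a) (b := K)
      (e' := S.x n ω - (A ^ k).mulVec (blockEstimate A C N j (ext n fun k => S.y k ω)))
      (e := S.blockError N j ω) (w := fun i => S.w (j * N + i) ω)
      (v := fun i => S.v (j * N + i) ω) (by
        rw [hest, hsplit]
        refine (norm_add_le _ _).trans (add_le_add ?_ ((hK _ k ω hkN.le).trans ?_))
        · refine (Matrix.linfty_opNorm_mulVec _ _).trans ?_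
          gcongr
          exact Finset.single_le_sum (f := fun k => ‖A ^ k‖) (fun _ _ => norm_nonneg _)
            (Finset.mem_range.2 hkN)
        · gcongr
          exact le_add_of_nonneg_right (norm_nonneg _))
    rwa [Finset.card_range] at hnorm
  have hmeas : Measurable fun ω => ENNReal.ofReal (2 * a ^ 2) * ‖S.blockError N j ω‖ₑ ^ 2 :=
    ((S.measurable_blockError N j).enorm.pow_const 2).const_mul _
  refine (lintegral_mono hpt).trans ?_
  rw [lintegral_const_mul' _ _ (ENNReal.natCast_ne_top m), lintegral_add_left hmeas,
    lintegral_const_mul' _ _ ENNReal.ofReal_ne_top, lintegral_const_mul' _ _ ENNReal.ofReal_ne_top]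
  gcongr
  · exact hbound j
  · exact S.lintegral_noise_le _ _

end IntermittentSystem

theorem mainTheorem3 {m g l : ℕ} (A : Matrix (Fin m) (Fin m) ℂ)
    (B : Matrix (Fin m) (Fin g) ℂ) (C : Matrix (Fin l) (Fin m) ℂ)
    (σ σ' pe : ℝ) (hσ : 0 < σ) (hσ' : 0 < σ')
    (hAB : IsControllable A B) (hAC : IsObservable A C) (hcyc : NoEigenvalueCycles A)
    (lam_max : ℂ) (hmem : lam_max ∈ spectrum ℂ A)
    (hmax : ∀ μ ∈ spectrum ℂ A, ‖μ‖ ≤ ‖lam_max‖)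
    {Ω : Type*} [MeasurableSpace Ω] (P : Measure Ω) [IsProbabilityMeasure P]
    (S : IntermittentSystem A B C σ σ' pe P) :
    S.IsIntermittentObservable ↔ ENNReal.ofReal pe < 1 / ‖lam_max‖ₑ ^ 2 := by
  have hm : m ≠ 0 := by
    rintro rfl
    rw [spectrum.of_subsingleton] at hmem
    exact hmem
  -- With no outputs the observability matrix has rank `0`, whereas `m ≠ 0`.
  have hl : 0 < l := by
    rw [Nat.pos_iff_ne_zero]
    rintro rfl
    have h := Matrix.rank_le_card_height (Matrix.of fun (ki : Fin m × Fin 0) (j : Fin m) =>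
      (C * A ^ (ki.1 : ℕ)) ki.2 j)
    rw [show _ = m from hAC] at h
    simp at h
    exact hm h
  rw [ofReal_lt_one_div_enorm_sq_iff]
  exact ⟨S.lt_one_of_isIntermittentObservable hσ' hAB hmem,
    S.isIntermittentObservable_of_lt_one hσ' hl hAC hcyc (norm_nonneg _) hmax⟩
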